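/- Let $(N,g)$ be a complete Riemannian manifold of dimension $n$ (smooth, without boundary, connected), with Riemannian distance $d$, and let $B_r$ denote the ball of radius $r$ about $0$ in $\mathbb{R}^2$ with the Euclidean metric $\sum_{i=1}^2 (dx^i)^2$. Then there is a constant $\varepsilon$ with $0<\varepsilon\le 1$, depending only on $(N,g)$, such that the following holds. Let $\varphi: B_2\to N$ be a smooth map on the open ball of radius $2$ which is harmonic (a critical point of the energy $\int g(\partial_\alpha\varphi,\partial_\alpha\varphi)\,dx$, summed over $\alpha=1,2$, with respect to compactly supported smooth variations) and conformal in the weak sense ($|\partial_1\varphi|^2=|\partial_2\varphi|^2$ and $\langle\partial_1\varphi,\partial_2\varphi\rangle=0$, zeros of $d\varphi$ being allowed), and suppose that $\varphi(B_2)$ is contained in a normal neighborhood of $\varphi(0)$, that is, in the diffeomorphic image under $\exp_{\varphi(0)}$ of an open star-shaped neighborhood of $0$ in $T_{\varphi(0)}N$. Put $\rho^2(y)=d(\varphi(0),y)^2$. Then there is a constant $C$, independent of $r_1$ and $r_2$ (it may depend on $\varphi$ and $g$), such that $$\max_{\overline{B}_{r_2}}\rho^2(\varphi(x))\le\Big(\frac{r_2}{r_1}\Big)^{C}\max_{\overline{B}_{r_1}}\rho^2(\varphi(x))\qquad\text{for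 all } 0<r_1\le r_2\le\varepsilon .$$ -/

import Mathlib

open Set Metric MeasureTheory Bundle Manifold
open scoped ContDiff

noncomputable section

section HarmonicMapDefs

variable (n : ℕ) {N : Type*} [TopologicalSpace N] [ChartedSpace (EuclideanSpace ℝ (Fin n)) N]
  [RiemannianBundle (fun x : N ↦ TangentSpace (𝓡 n) x)]

/-- The pull-back metric `φ^* g` at the point `x`, evaluated on the vectors `v`, `w`. -/
def pullbackMetric {m : ℕ} (φ : EuclideanSpace ℝ (Fin m) → N) (x v w : EuclideanSpace ℝ (Fin m)) :
    ℝ :=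
  inner ℝ (mfderiv (𝓡 m) (𝓡 n) φ x v) (mfderiv (𝓡 m) (𝓡 n) φ x w)

/-- The energy density `e(φ) = ∑_α g(∂_α φ, ∂_α φ)` of a map from a Euclidean space. -/
def energyDensity {m : ℕ} (φ : EuclideanSpace ℝ (Fin m) → N) (x : EuclideanSpace ℝ (Fin m)) : ℝ :=
  ∑ α, pullbackMetric n φ x (EuclideanSpace.single α 1) (EuclideanSpace.single α 1)

/-- `Φ : (t, x) ↦ Φ (t, x)` is a smooth variation of `φ` on `Ω` which is fixed outside `K`. -/
structure IsVariation {m : ℕ} (φ : EuclideanSpace ℝ (Fin m) → N)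
    (Ω K : Set (EuclideanSpace ℝ (Fin m))) (δ : ℝ) (Φ : ℝ × EuclideanSpace ℝ (Fin m) → N) :
    Prop where
  smooth : ContMDiffOn 𝓘(ℝ, ℝ × EuclideanSpace ℝ (Fin m)) (𝓡 n) ∞ Φ (Ioo (-δ) δ ×ˢ Ω)
  zero : ∀ x ∈ Ω, Φ (0, x) = φ x
  fixed : ∀ t ∈ Ioo (-δ) δ, ∀ x ∈ Ω \ K, Φ (t, x) = φ x

/-- A harmonic map on an open subset `Ω` of the plane with the Euclidean metric: a smooth map
which is a critical point of the energy with respect to compactly supported variations. -/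
structure IsHarmonicOn (φ : EuclideanSpace ℝ (Fin 2) → N) (Ω : Set (EuclideanSpace ℝ (Fin 2))) :
    Prop where
  smooth : ContMDiffOn (𝓡 2) (𝓡 n) ∞ φ Ω
  critical : ∀ K ⊆ Ω, IsCompact K → ∀ δ > 0, ∀ Φ : ℝ × EuclideanSpace ℝ (Fin 2) → N,
    IsVariation n φ Ω K δ Φ →
      HasDerivAt (fun t : ℝ ↦ ∫ x in K, energyDensity n (fun y ↦ Φ (t, y)) x) 0 0

/-- (Weak) conformality on a subset `Ω` of the plane: `φ^* g = (1/2) e(φ) h`, where `h` is the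
Euclidean metric. The differential is allowed to vanish. -/
def IsConformalOn (φ : EuclideanSpace ℝ (Fin 2) → N) (Ω : Set (EuclideanSpace ℝ (Fin 2))) : Prop :=
  ∀ x ∈ Ω, ∀ v w : EuclideanSpace ℝ (Fin 2),
    pullbackMetric n φ x v w = 1 / 2 * energyDensity n φ x * inner ℝ v w

/-- The matrix `(g_{ij})` of the metric in the local coordinates `ψ`, at the point with
coordinates `y`. -/
def metricMatrix (ψ : OpenPartialHomeomorph N (EuclideanSpace ℝ (Fin n)))
    (y : EuclideanSpace ℝ (Fin n)) : Matrix (Fin n) (Fin n) ℝ :=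
  Matrix.of fun i j ↦
    pullbackMetric n ψ.symm y (EuclideanSpace.single i 1) (EuclideanSpace.single j 1)

/-- The coordinate derivative `∂ g_{ij} / ∂ y^k` at the point with coordinates `y`. -/
def metricDeriv (ψ : OpenPartialHomeomorph N (EuclideanSpace ℝ (Fin n))) (k i j : Fin n)
    (y : EuclideanSpace ℝ (Fin n)) : ℝ :=
  fderiv ℝ (fun z ↦ metricMatrix n ψ z i j) y (EuclideanSpace.single k 1)

/-- The Christoffel symbol `Γ^k_{ij}` of the Levi-Civita connection in the local coordinates `ψ`,
at the point with coordinates `y`. -/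
def christoffel (ψ : OpenPartialHomeomorph N (EuclideanSpace ℝ (Fin n))) (k i j : Fin n)
    (y : EuclideanSpace ℝ (Fin n)) : ℝ :=
  1 / 2 * ∑ l, (metricMatrix n ψ y)⁻¹ k l *
    (metricDeriv n ψ i j l y + metricDeriv n ψ j i l y - metricDeriv n ψ l i j y)

/-- A smooth curve satisfying the geodesic equation on the open set `s` of times, in all smooth
local coordinates. -/
structure IsGeodesicOn (γ : ℝ → N) (s : Set ℝ) : Prop where
  smooth : ContMDiffOn 𝓘(ℝ, ℝ) (𝓡 n) ∞ γ s
  eq : ∀ ψ ∈ IsManifold.maximalAtlas (𝓡 n) ∞ N, ∀ t ∈ s, γ t ∈ ψ.source → ∀ k : Fin n,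
    deriv (deriv fun τ ↦ ψ (γ τ) k) t
      + ∑ i, ∑ j, christoffel n ψ k i j (ψ (γ t))
          * deriv (fun τ ↦ ψ (γ τ) i) t * deriv (fun τ ↦ ψ (γ τ) j) t = 0

/-- `ψ` is a system of normal coordinates centred at `p`: the rays through the origin of its
star-shaped range are geodesics, and the coordinate frame at `p` is orthonormal. In other words
`ψ⁻¹ = exp_p ∘ L`, where `L = d(ψ⁻¹)_0` is a linear isometry from `ℝⁿ` onto the tangent space at
`p`. -/
structure IsNormalChart (p : N) (ψ : OpenPartialHomeomorph N (EuclideanSpace ℝ (Fin n))) :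
    Prop where
  mem_atlas : ψ ∈ IsManifold.maximalAtlas (𝓡 n) ∞ N
  mem_source : p ∈ ψ.source
  map_center : ψ p = 0
  starConvex : StarConvex ℝ 0 ψ.target
  orthonormal : metricMatrix n ψ 0 = 1
  geodesic : ∀ v : EuclideanSpace ℝ (Fin n),
    IsGeodesicOn n (fun t : ℝ ↦ ψ.symm (t • v)) {t : ℝ | t • v ∈ ψ.target}

/-- A normal neighborhood of `p`: the diffeomorphic image, under the exponential map at `p`, of an
open star-shaped neighborhood of the origin of the tangent space. Equivalently, after the choice
of an orthonormal frame at `p`, the domain of a system of normal coordinates centred at `p`. -/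
def IsNormalNeighborhood (p : N) (U : Set N) : Prop :=
  ∃ ψ : OpenPartialHomeomorph N (EuclideanSpace ℝ (Fin n)), IsNormalChart n p ψ ∧ ψ.source = U

end HarmonicMapDefs

end

/-! ### Calculus in a chart. -/

section ChartDifferentiability

variable {n : ℕ} {N : Type*} [TopologicalSpace N] [ChartedSpace (EuclideanSpace ℝ (Fin n)) N]
  {ψ : OpenPartialHomeomorph N (EuclideanSpace ℝ (Fin n))}

/-! In a chart `ψ` centred at φ(0), harmonicity of φ becomes an equation for u = ψ ∘ φ, with u(0) =
0, that expresses Δu as a quadratic form in ∇u with coefficients smooth in u. On a compact ball ∇u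
is bounded, so |Δu| ≤ C|∇u| (`IsHarmonicOn.exists_norm_laplacian_sq_le`). The complex gradient w =
∂u/∂z therefore satisfies |∂w/∂z̄| ≤ C|w|. Strong unique continuation holds for this inequality
(`eq_zero_of_norm_dbar_le_of_flat`), through a Carleman estimate with weights |x|^(-2k) exp(c|x|²)
whose constant does not depend on k. So either φ is constant on a neighbourhood of the closed unit
ball, and both maxima are zero, or du vanishes at 0 to some exact finite order j.

In the second case |du| ≤ A|x|^j on the unit ball, while max |u| over the ball of radius r is at
least a constant times r^(j+1) for all small r (`ContDiff.iteratedFDeriv_eq_zero_of_small_on_balls`,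
by contraposition). Comparing the metric with the Euclidean one in the chart transfers both bounds
to ρ = d(φ(0), φ).

A plain comparison with r^(j+1) would leave a constant in front of the power of r₂/r₁, which is
impossible at r₁ = r₂. Instead the increment of m(r) = max ρ is estimated: m(r₂) - m(r₁) ≤
A(r₂^(j+1) - r₁^(j+1)), by integration along a ray. With m(r₁) ≥ c r₁^(j+1) and Q = (r₂/r₁)^(j+1)
this gives m(r₂) ≤ (1 + B(Q - 1)) m(r₁) ≤ Q^B m(r₁) for B = max(1, A/c), by Bernoulli's inequality
(`exists_isGreatest_sq_le_rpow_mul`). All of this takes place on the closed unit ball, so ε = 1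
works for every (N, g). -/

theorem mdifferentiableAt_chart_symm
    (hψ : ψ ∈ IsManifold.maximalAtlas (𝓡 n) ∞ N) {y : EuclideanSpace ℝ (Fin n)}
    (hy : y ∈ ψ.target) : MDifferentiableAt (𝓡 n) (𝓡 n) ψ.symm y :=
  ((contMDiffOn_symm_of_mem_maximalAtlas hψ).mdifferentiableOn (by simp)).mdifferentiableAt
    (ψ.open_target.mem_nhds hy)

theorem mdifferentiableAt_chart
    (hψ : ψ ∈ IsManifold.maximalAtlas (𝓡 n) ∞ N) {p : N}
    (hp : p ∈ ψ.source) : MDifferentiableAt (𝓡 n) (𝓡 n) ψ p :=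
  ((contMDiffOn_of_mem_maximalAtlas hψ).mdifferentiableOn (by simp)).mdifferentiableAt
    (ψ.open_source.mem_nhds hp)

/-- Chain rule for a map written in a chart. -/
theorem mfderiv_chart_symm_comp {E : Type*} [NormedAddCommGroup E] [NormedSpace ℝ E]
    (hψ : ψ ∈ IsManifold.maximalAtlas (𝓡 n) ∞ N) {v : E → EuclideanSpace ℝ (Fin n)} {x : E}
    (hv : DifferentiableAt ℝ v x) (hx : v x ∈ ψ.target) (a : E) :
    mfderiv 𝓘(ℝ, E) (𝓡 n) (fun z ↦ ψ.symm (v z)) x a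
      = mfderiv (𝓡 n) (𝓡 n) ψ.symm (v x) (fderiv ℝ v x a) := by
  have := mfderiv_comp (I := 𝓘(ℝ, E)) (I' := 𝓡 n) (I'' := 𝓡 n) x
    (mdifferentiableAt_chart_symm hψ hx) hv.mdifferentiableAt
  rw [mfderiv_eq_fderiv] at this
  exact congr($this a)

end ChartDifferentiability

/-! ### The metric tensor in a chart. -/

section ChartMetric

variable {n : ℕ} {N : Type*} [TopologicalSpace N] [ChartedSpace (EuclideanSpace ℝ (Fin n)) N]
  [RiemannianBundle (fun x : N ↦ TangentSpace (𝓡 n) x)]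

/-- The metric in the chart `ψ`, as a bilinear form on the model space. -/
noncomputable def chartMetric (ψ : OpenPartialHomeomorph N (EuclideanSpace ℝ (Fin n)))
    (y : EuclideanSpace ℝ (Fin n)) :
    EuclideanSpace ℝ (Fin n) →L[ℝ] EuclideanSpace ℝ (Fin n) →L[ℝ] ℝ :=
  LinearMap.toContinuousLinearMap <| LinearMap.toContinuousLinearMap.toLinearMap ∘ₗ
    LinearMap.mk₂ ℝ (fun v w ↦ pullbackMetric n ψ.symm y v w)
    (fun a b c ↦ by
      have h := (mfderiv (𝓡 n) (𝓡 n) ψ.symm y).map_add a b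
      exact (congrArg (fun z ↦ inner ℝ z (mfderiv (𝓡 n) (𝓡 n) ψ.symm y c)) h).trans
        (inner_add_left _ _ _))
    (fun a b c ↦ by
      have h := (mfderiv (𝓡 n) (𝓡 n) ψ.symm y).map_smul a b
      exact (congrArg (fun z ↦ inner ℝ z (mfderiv (𝓡 n) (𝓡 n) ψ.symm y c)) h).trans
        (real_inner_smul_left _ _ _))
    (fun a b c ↦ by
      have h := (mfderiv (𝓡 n) (𝓡 n) ψ.symm y).map_add b c
      exact (congrArg (inner ℝ (mfderiv (𝓡 n) (𝓡 n) ψ.symm y a)) h).trans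
        (inner_add_right _ _ _))
    (fun a b c ↦ by
      have h := (mfderiv (𝓡 n) (𝓡 n) ψ.symm y).map_smul a c
      exact (congrArg (inner ℝ (mfderiv (𝓡 n) (𝓡 n) ψ.symm y b)) h).trans
        (real_inner_smul_right _ _ _))

theorem chartMetric_apply (ψ : OpenPartialHomeomorph N (EuclideanSpace ℝ (Fin n)))
    (y v w : EuclideanSpace ℝ (Fin n)) :
    chartMetric ψ y v w = pullbackMetric n ψ.symm y v w := rfl

theorem chartMetric_comm (ψ : OpenPartialHomeomorph N (EuclideanSpace ℝ (Fin n)))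
    (y v w : EuclideanSpace ℝ (Fin n)) :
    chartMetric ψ y v w = chartMetric ψ y w v := by
  simp only [chartMetric_apply, pullbackMetric]
  exact real_inner_comm _ _

variable {ψ : OpenPartialHomeomorph N (EuclideanSpace ℝ (Fin n))}

theorem contDiffOn_chartMetric [IsManifold (𝓡 n) ∞ N]
    [IsContMDiffRiemannianBundle (𝓡 n) ∞ (EuclideanSpace ℝ (Fin n))
      (fun x : N ↦ TangentSpace (𝓡 n) x)]
    (hψ : ψ ∈ IsManifold.maximalAtlas (𝓡 n) ∞ N) :
    ContDiffOn ℝ ∞ (chartMetric ψ) ψ.target := by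
  rw [contDiffOn_clm_apply]
  intro v
  rw [contDiffOn_clm_apply]
  intro w
  rw [← contMDiffOn_iff_contDiffOn]
  have hσ : ContMDiffOn (𝓡 n) (𝓡 n) ∞ ψ.symm ψ.target :=
    contMDiffOn_symm_of_mem_maximalAtlas hψ
  -- The tangent map of `ψ.symm`, applied to a constant vector field, is a smooth section along
  -- `ψ.symm`; the smooth bundle metric can then be evaluated on two such sections.
  have key : ∀ v : EuclideanSpace ℝ (Fin n),
      ContMDiffOn (𝓡 n) ((𝓡 n).prod (𝓡 n)) ∞
        (fun y ↦ (⟨ψ.symm y, mfderiv (𝓡 n) (𝓡 n) ψ.symm y v⟩ : TangentBundle (𝓡 n) N))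
        ψ.target := by
    intro v
    have h1 := hσ.contMDiffOn_tangentMapWithin (m := ∞) (by simp) ψ.open_target.uniqueMDiffOn
    have h2 : ContMDiffOn (𝓡 n) ((𝓡 n).prod (𝓡 n)) ∞
        (fun y : EuclideanSpace ℝ (Fin n) ↦
          (⟨y, v⟩ : TangentBundle (𝓡 n) (EuclideanSpace ℝ (Fin n)))) ψ.target := by
      have := (contMDiffOn_vectorSpace_iff_contDiffOn (𝕜 := ℝ)
        (V := fun _ : EuclideanSpace ℝ (Fin n) ↦ v) (s := ψ.target) (n := ∞)).2 contDiffOn_const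
      exact this
    have h3 := h1.comp h2 (fun y hy ↦ hy)
    refine h3.congr fun y hy ↦ ?_
    simp [tangentMapWithin, mfderivWithin_of_isOpen ψ.open_target hy]
  exact (key v).inner_bundle (key w)

/-- The differential of `ψ.symm` is injective, because the differential of `ψ` is a left inverse of
it. -/
theorem chartMetric_self_pos
    (hψ : ψ ∈ IsManifold.maximalAtlas (𝓡 n) ∞ N) {y : EuclideanSpace ℝ (Fin n)}
    (hy : y ∈ ψ.target) {v : EuclideanSpace ℝ (Fin n)} (hv : v ≠ 0) :
    0 < chartMetric ψ y v v := by
  rw [chartMetric_apply, pullbackMetric]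
  refine real_inner_self_pos.2 fun h ↦ hv ?_
  have hc := mfderiv_comp (I := 𝓡 n) (I' := 𝓡 n) (I'' := 𝓡 n) y
    (mdifferentiableAt_chart hψ (ψ.map_target hy)) (mdifferentiableAt_chart_symm hψ hy)
  have hid : mfderiv (𝓡 n) (𝓡 n) (ψ ∘ ψ.symm) y = ContinuousLinearMap.id ℝ _ := by
    rw [← mfderiv_id (I := 𝓡 n) (x := y)]
    refine Filter.EventuallyEq.mfderiv_eq ?_
    filter_upwards [ψ.open_target.mem_nhds hy] with z hz using ψ.right_inv hz
  have := congr($hc v)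
  rw [hid] at this
  exact this.trans ((congrArg (mfderiv (𝓡 n) (𝓡 n) ψ (ψ.symm y)) h).trans (map_zero _))

theorem pullbackMetric_chart_symm_comp {m : ℕ}
    (hψ : ψ ∈ IsManifold.maximalAtlas (𝓡 n) ∞ N)
    {v : EuclideanSpace ℝ (Fin m) → EuclideanSpace ℝ (Fin n)} {x : EuclideanSpace ℝ (Fin m)}
    (hv : DifferentiableAt ℝ v x) (hx : v x ∈ ψ.target) (a b : EuclideanSpace ℝ (Fin m)) :
    pullbackMetric n (fun z ↦ ψ.symm (v z)) x a b
      = chartMetric ψ (v x) (fderiv ℝ v x a) (fderiv ℝ v x b) := by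
  rw [chartMetric_apply, pullbackMetric, pullbackMetric]
  have ha := mfderiv_chart_symm_comp hψ hv hx a
  have hb := mfderiv_chart_symm_comp hψ hv hx b
  congr 1

theorem norm_sq_mfderiv_chart_symm_comp {E : Type*} [NormedAddCommGroup E] [NormedSpace ℝ E]
    (hψ : ψ ∈ IsManifold.maximalAtlas (𝓡 n) ∞ N)
    {v : E → EuclideanSpace ℝ (Fin n)} {x : E}
    (hv : DifferentiableAt ℝ v x) (hx : v x ∈ ψ.target) (a : E) :
    ‖mfderiv 𝓘(ℝ, E) (𝓡 n) (fun z ↦ ψ.symm (v z)) x a‖ ^ 2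
      = chartMetric ψ (v x) (fderiv ℝ v x a) (fderiv ℝ v x a) := by
  rw [mfderiv_chart_symm_comp hψ hv hx a, chartMetric_apply, pullbackMetric]
  exact (real_inner_self_eq_norm_sq _).symm

end ChartMetric

/-! ### Differentiation under the integral and the fundamental lemma. -/

section CalculusOfVariations

theorem ContDiffOn.contDiff_smul_of_tsupport_subset {E F : Type*} [NormedAddCommGroup E]
    [NormedSpace ℝ E] [NormedAddCommGroup F] [NormedSpace ℝ F] {Ω : Set E} (hΩ : IsOpen Ω) {θ : E → ℝ}
    {k : ℕ∞ω} (hθ : ContDiff ℝ k θ) (hs : tsupport θ ⊆ Ω) {h : E → F}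
    (hh : ContDiffOn ℝ k h Ω) : ContDiff ℝ k fun x ↦ θ x • h x := by
  rw [contDiff_iff_contDiffAt]
  intro x
  by_cases hx : x ∈ Ω
  · exact hθ.contDiffAt.smul (hh.contDiffAt (hΩ.mem_nhds hx))
  · have : (fun x ↦ θ x • h x) =ᶠ[nhds x] fun _ ↦ 0 := by
      filter_upwards [(isClosed_tsupport θ).isOpen_compl.mem_nhds fun h ↦ hx (hs h)] with y hy
      rw [image_eq_zero_of_notMem_tsupport hy, zero_smul]
    exact contDiffAt_const.congr_of_eventuallyEq this

variable {E : Type*} [NormedAddCommGroup E] [NormedSpace ℝ E]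
  [MeasurableSpace E] [BorelSpace E]
  {μ : Measure E}

/-- Differentiation under the integral sign over a compact set. -/
theorem hasDerivAt_setIntegral_of_contDiffOn [IsFiniteMeasureOnCompacts μ]
    {δ : ℝ} (hδ : 0 < δ) {Ω K : Set E}
    (hΩ : IsOpen Ω) (hK : IsCompact K) (hKΩ : K ⊆ Ω) {G : ℝ × E → ℝ}
    (hG : ContDiffOn ℝ 1 G (Ioo (-δ) δ ×ˢ Ω)) :
    HasDerivAt (fun t : ℝ ↦ ∫ x in K, G (t, x) ∂μ)
      (∫ x in K, fderiv ℝ G (0, x) (1, 0) ∂μ) 0 := by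
  have hop : IsOpen (Ioo (-δ) δ ×ˢ Ω) := isOpen_Ioo.prod hΩ
  have hd : ∀ t ∈ Ioo (-δ) δ, ∀ x ∈ Ω,
      HasDerivAt (fun s ↦ G (s, x)) (fderiv ℝ G (t, x) (1, 0)) t := by
    intro t ht x hx
    have h1 : HasFDerivAt G (fderiv ℝ G (t, x)) (t, x) :=
      ((hG.differentiableOn one_ne_zero).differentiableAt
        (hop.mem_nhds ⟨ht, hx⟩)).hasFDerivAt
    have h2 : HasDerivAt (fun s : ℝ ↦ (s, x)) ((1 : ℝ), (0 : E)) t :=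
      (hasDerivAt_id t).prodMk (hasDerivAt_const t x)
    exact h1.comp_hasDerivAt t h2
  have hc : ContinuousOn (fun z ↦ fderiv ℝ G z (1, 0)) (Ioo (-δ) δ ×ˢ Ω) :=
    (hG.continuousOn_fderiv_of_isOpen hop le_rfl).clm_apply continuousOn_const
  -- Halving the time interval makes it compact, which yields one bound for the t-derivative.
  have hsub : Icc (-(δ / 2)) (δ / 2) ×ˢ K ⊆ Ioo (-δ) δ ×ˢ Ω := by
    rintro ⟨t, x⟩ ⟨ht, hx⟩
    exact ⟨⟨by linarith [ht.1], by linarith [ht.2]⟩, hKΩ hx⟩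
  obtain ⟨B, hB⟩ := (isCompact_Icc.prod hK).exists_bound_of_continuousOn (hc.mono hsub)
  have hslice : ∀ t ∈ Ioo (-δ) δ, ContinuousOn (fun x ↦ G (t, x)) K := fun t ht ↦
    hG.continuousOn.comp (by fun_prop) fun x hx ↦ ⟨ht, hKΩ hx⟩
  have h0 : (0 : ℝ) ∈ Ioo (-δ) δ := ⟨by linarith, hδ⟩
  refine (hasDerivAt_integral_of_dominated_loc_of_deriv_le (μ := μ.restrict K)
    (F := fun t x ↦ G (t, x)) (F' := fun t x ↦ fderiv ℝ G (t, x) (1, 0)) (bound := fun _ ↦ B)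
    (s := Ioo (-(δ / 2)) (δ / 2)) (Ioo_mem_nhds (by linarith) (by linarith)) ?_ ?_ ?_ ?_ ?_ ?_).2
  · filter_upwards [Ioo_mem_nhds h0.1 h0.2] with t ht
    exact (hslice t ht).aestronglyMeasurable hK.measurableSet
  · exact (hslice 0 h0).integrableOn_compact hK
  · exact (hc.comp (t := Ioo (-δ) δ ×ˢ Ω) (by fun_prop)
      fun x hx ↦ ⟨h0, hKΩ hx⟩).aestronglyMeasurable hK.measurableSet
  · filter_upwards [ae_restrict_mem hK.measurableSet] with x hx t ht
    exact hB (t, x) ⟨⟨ht.1.le, ht.2.le⟩, hx⟩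
  · exact (continuousOn_const.integrableOn_compact hK)
  · filter_upwards [ae_restrict_mem hK.measurableSet] with x hx t ht
    exact hd t ⟨by linarith [ht.1], by linarith [ht.2]⟩ x (hKΩ hx)

/-- The integral of a directional derivative of a compactly supported function vanishes. -/
theorem integral_fderiv_apply_eq_zero [FiniteDimensional ℝ E] [μ.IsAddHaarMeasure] {f : E → ℝ} (hf : ContDiff ℝ 1 f)
    (hs : HasCompactSupport f) (v : E) : ∫ x, fderiv ℝ f x v ∂μ = 0 := by
  have hc : Continuous fun x ↦ fderiv ℝ f x v := (hf.continuous_fderiv one_ne_zero).clm_apply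
    continuous_const
  have hi : Integrable (fun x ↦ fderiv ℝ f x v) μ :=
    hc.integrable_of_hasCompactSupport (hs.fderiv_apply ℝ v)
  have := integral_mul_fderiv_eq_neg_fderiv_mul_of_integrable (μ := μ) (𝕜 := ℝ)
    (f := fun _ ↦ (1 : ℝ)) (g := f) (v := v) (by simp) (by simpa using hi)
    (by simpa using hf.continuous.integrable_of_hasCompactSupport hs) (by fun_prop)
    (fun x _ ↦ hf.differentiable one_ne_zero x)
  simpa using this

/-- The fundamental lemma of the calculus of variations, after an integration by parts. -/
theorem eq_sum_fderiv_of_forall_integral_eq_zero [FiniteDimensional ℝ E] [μ.IsAddHaarMeasure] {ι : Type*} [Fintype ι]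
    (e : ι → E) {Ω : Set E}
    (hΩ : IsOpen Ω) {a : E → ℝ} (ha : ContinuousOn a Ω) {h : ι → E → ℝ}
    (hh : ∀ α, ContDiffOn ℝ 1 (h α) Ω)
    (H : ∀ θ : E → ℝ, ContDiff ℝ ∞ θ → HasCompactSupport θ → tsupport θ ⊆ Ω →
      ∫ x in tsupport θ, (θ x * a x + ∑ α, fderiv ℝ θ x (e α) * h α x) ∂μ = 0)
    {x : E} (hx : x ∈ Ω) : a x = ∑ α, fderiv ℝ (h α) x (e α) := by
  have hc : ContinuousOn (fun x ↦ a x - ∑ α, fderiv ℝ (h α) x (e α)) Ω :=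
    ha.sub <| continuousOn_finsetSum _ fun α _ ↦
      ((hh α).continuousOn_fderiv_of_isOpen hΩ le_rfl).clm_apply continuousOn_const
  have hae : ∀ᵐ x ∂μ, x ∈ Ω → a x - ∑ α, fderiv ℝ (h α) x (e α) = 0 := by
    refine hΩ.ae_eq_zero_of_integral_contDiff_smul_eq_zero
      (hc.locallyIntegrableOn hΩ.measurableSet) fun θ hθ hθc hθs ↦ ?_
    have hθ1 : ContDiff ℝ 1 θ := hθ.of_le (by simp)
    have hprod : ∀ α, ContDiff ℝ 1 fun x ↦ θ x • h α x := fun α ↦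
      (hh α).contDiff_smul_of_tsupport_subset hΩ hθ1 hθs
    have hz : ∀ α, ∫ x, fderiv ℝ (fun x ↦ θ x • h α x) x (e α) ∂μ = 0 := fun α ↦
      integral_fderiv_apply_eq_zero (hprod α) hθc.smul_right _
    have hzi : ∀ α, Integrable (fun x ↦ fderiv ℝ (fun x ↦ θ x • h α x) x (e α)) μ := fun α ↦
      ((hprod α).continuous_fderiv one_ne_zero |>.clm_apply
        continuous_const).integrable_of_hasCompactSupport (hθc.smul_right.fderiv_apply ℝ (e α))
    have h1 := H θ hθ hθc hθs
    rw [setIntegral_eq_integral_of_forall_compl_eq_zero] at h1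
    · have hint : Integrable (fun x ↦ θ x • (a x - ∑ α, fderiv ℝ (h α) x (e α))) μ := by
        have h0 : ContDiffOn ℝ 0 (fun x ↦ a x - ∑ α, fderiv ℝ (h α) x (e α)) Ω :=
          contDiffOn_zero.2 hc
        exact (h0.contDiff_smul_of_tsupport_subset hΩ (hθ.of_le (by simp))
          hθs).continuous.integrable_of_hasCompactSupport hθc.smul_right
      -- The integration by parts, pointwise: the integrand is θ times the Euler-Lagrange expression
      -- plus the divergence of θh, whose integral vanishes.
      have heq : ∀ x, θ x * a x + ∑ α, fderiv ℝ θ x (e α) * h α x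
          = θ x • (a x - ∑ α, fderiv ℝ (h α) x (e α))
            + ∑ α, fderiv ℝ (fun x ↦ θ x • h α x) x (e α) := by
        intro x
        by_cases hx : x ∈ Ω
        · have : ∀ α, fderiv ℝ (fun x ↦ θ x • h α x) x (e α)
              = θ x * fderiv ℝ (h α) x (e α) + fderiv ℝ θ x (e α) * h α x := by
            intro α
            rw [fderiv_fun_smul (hθ1.differentiable one_ne_zero x)
              (((hh α).differentiableOn one_ne_zero).differentiableAt (hΩ.mem_nhds hx))]
            simp
          rw [Finset.sum_congr rfl fun α _ ↦ this α]
          simp only [Finset.sum_add_distrib, smul_eq_mul, mul_sub, Finset.mul_sum]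
          ring
        · have hx' : x ∉ tsupport θ := fun h ↦ hx (hθs h)
          have h2 : ∀ α, fderiv ℝ (fun x ↦ θ x • h α x) x = 0 := fun α ↦
            image_eq_zero_of_notMem_tsupport fun hy ↦ hx'
              (tsupport_smul_subset_left θ (h α) (tsupport_fderiv_subset ℝ hy))
          have h3 : fderiv ℝ θ x = 0 :=
            image_eq_zero_of_notMem_tsupport fun h ↦ hx' (tsupport_fderiv_subset ℝ h)
          rw [Finset.sum_congr rfl fun α _ ↦ congr($(h2 α) (e α))]
          simp [image_eq_zero_of_notMem_tsupport hx', h3]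
      simp only [heq] at h1
      rw [integral_add hint (integrable_finsetSum _ fun α _ ↦ hzi α),
        integral_finsetSum _ fun α _ ↦ hzi α] at h1
      rwa [Finset.sum_congr rfl fun α _ ↦ hz α, Finset.sum_const_zero, add_zero] at h1
    · intro x hx
      have h3 : fderiv ℝ θ x = 0 :=
        image_eq_zero_of_notMem_tsupport fun h ↦ hx (tsupport_fderiv_subset ℝ h)
      simp [image_eq_zero_of_notMem_tsupport hx, h3]
  have hEq := Measure.eqOn_open_of_ae_eq (μ := μ) (U := Ω)
    (f := fun x ↦ a x - ∑ α, fderiv ℝ (h α) x (e α)) (g := fun _ ↦ 0)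
    ((ae_restrict_iff' hΩ.measurableSet).2 hae) hΩ hc continuousOn_const
  exact sub_eq_zero.1 (hEq hx)

end CalculusOfVariations

/-! ### First variation of the energy for a variable metric on a vector space. -/

section FirstVariation

theorem HasFDerivAt.hasDerivAt_add_smul {F G : Type*} [NormedAddCommGroup F] [NormedSpace ℝ F]
    [NormedAddCommGroup G] [NormedSpace ℝ G] {g : F → G} {g' : F →L[ℝ] G} {y c : F}
    (h : HasFDerivAt g g' y) (r : ℝ) :
    HasDerivAt (fun s : ℝ ↦ g (y + (s * r) • c)) (r • g' c) 0 := by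
  have h1 : HasDerivAt (fun s : ℝ ↦ y + (s * r) • c) (r • c) 0 := by
    simpa using (((hasDerivAt_id (0 : ℝ)).mul_const r).smul_const c).const_add y
  have h2 : HasFDerivAt g g' (y + ((0 : ℝ) * r) • c) := by simpa using h
  rw [← map_smul]
  exact h2.comp_hasDerivAt (0 : ℝ) h1

theorem HasFDerivAt.hasDerivAt_line {F G : Type*} [NormedAddCommGroup F] [NormedSpace ℝ F]
    [NormedAddCommGroup G] [NormedSpace ℝ G] {f : F → G} {f' : F →L[ℝ] G} {x : F}
    (h : HasFDerivAt f f' x) (v : F) : HasDerivAt (fun s : ℝ ↦ f (x + s • v)) (f' v) 0 := by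
  simpa using h.hasDerivAt_add_smul (c := v) 1

theorem HasFDerivAt.hasDerivAt_comp_line {E F G : Type*} [NormedAddCommGroup E]
    [NormedSpace ℝ E] [NormedAddCommGroup F] [NormedSpace ℝ F] [NormedAddCommGroup G]
    [NormedSpace ℝ G] {g : F → G} {g' : F →L[ℝ] G} {u : E → F} {u' : E →L[ℝ] F} {x : E}
    (hg : HasFDerivAt g g' (u x)) (hu : HasFDerivAt u u' x) (v : E) :
    HasDerivAt (fun s : ℝ ↦ g (u (x + s • v))) (g' (u' v)) 0 :=
  (hg.comp x hu).hasDerivAt_line v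

theorem ContDiffOn.fderiv_comp_apply {E F G : Type*} [NormedAddCommGroup E] [NormedSpace ℝ E]
    [NormedAddCommGroup F] [NormedSpace ℝ F] [NormedAddCommGroup G] [NormedSpace ℝ G]
    {g : F → G} {T : Set F} (hg : ContDiffOn ℝ ∞ g T) (hT : IsOpen T) {u : E → F} {Ω : Set E}
    (hu : ContDiffOn ℝ ∞ u Ω) (huT : MapsTo u Ω T) (c : F) :
    ContDiffOn ℝ ∞ (fun y ↦ fderiv ℝ g (u y) c) Ω :=
  ((hg.fderiv_of_isOpen hT (m := ∞) (by simp)).comp hu huT).clm_apply contDiffOn_const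

set_option synthInstance.maxHeartbeats 200000 in
theorem HasDerivAt.bilinear_apply {F : Type*} [NormedAddCommGroup F] [NormedSpace ℝ F]
    {B : ℝ → F →L[ℝ] F →L[ℝ] ℝ} {B' : F →L[ℝ] F →L[ℝ] ℝ} {v w : ℝ → F} {v' w' : F} {t : ℝ}
    (hB : HasDerivAt B B' t) (hv : HasDerivAt v v' t) (hw : HasDerivAt w w' t) :
    HasDerivAt (fun s ↦ B s (v s) (w s))
      (B' (v t) (w t) + B t v' (w t) + B t (v t) w') t := by
  have h1 : HasDerivAt (fun s ↦ B s (v s)) (B' (v t) + B t v') t := hB.clm_apply hv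
  have h2 := h1.clm_apply hw
  rwa [add_apply] at h2

/-- Keeps the linear variation u + tθc inside the chart for small t: the image of the support of θ
is compact, hence has a thickening in T, and off the support nothing moves. -/
theorem exists_forall_add_smul_mem {E F : Type*} [NormedAddCommGroup E]
    [NormedAddCommGroup F] [NormedSpace ℝ F] {u : E → F} {θ : E → ℝ} {Ω : Set E} {T : Set F}
    (hT : IsOpen T) (hu : ContinuousOn u Ω) (huT : MapsTo u Ω T) (hθ : Continuous θ)
    (hθc : HasCompactSupport θ) (hθs : tsupport θ ⊆ Ω) (c : F) :
    ∃ δ > 0, ∀ t ∈ Ioo (-δ) δ, ∀ x ∈ Ω, u x + (t * θ x) • c ∈ T := by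
  have hK : IsCompact (u '' tsupport θ) := hθc.isCompact.image_of_continuousOn (hu.mono hθs)
  obtain ⟨r, hr, hrT⟩ := hK.exists_thickening_subset_open hT
    (image_subset_iff.2 fun x hx ↦ huT (hθs hx))
  obtain ⟨B, hB⟩ := hθ.bounded_above_of_compact_support hθc
  have hB0 : 0 ≤ B := (norm_nonneg _).trans (hB 0)
  -- Any such t gives |tθc| < r; the added ones keep the denominator positive.
  refine ⟨r / ((B + 1) * (‖c‖ + 1)), by positivity, fun t ht x hx ↦ ?_⟩
  by_cases hxK : x ∈ tsupport θ
  · apply hrT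
    rw [mem_thickening_iff]
    refine ⟨u x, mem_image_of_mem _ hxK, ?_⟩
    rw [dist_eq_norm, add_sub_cancel_left, norm_smul, norm_mul]
    have ht' : ‖t‖ < r / ((B + 1) * (‖c‖ + 1)) := abs_lt.2 ht
    calc ‖t‖ * ‖θ x‖ * ‖c‖ ≤ ‖t‖ * (B + 1) * (‖c‖ + 1) := by
          gcongr
          · linarith [hB x]
          · linarith
      _ < r / ((B + 1) * (‖c‖ + 1)) * ((B + 1) * (‖c‖ + 1)) := by
          rw [mul_assoc]; gcongr
      _ = r := by field_simp
  · simpa [image_eq_zero_of_notMem_tsupport hxK] using huT hx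

variable {E F : Type*} [NormedAddCommGroup E] [NormedSpace ℝ E]
  [NormedAddCommGroup F] [NormedSpace ℝ F]

/-- The energy density of `u + t θ c` in coordinates, for the metric `g`. -/
noncomputable def variationDensity {ι : Type*} [Fintype ι] (e : ι → E) (g : F → F →L[ℝ] F →L[ℝ] ℝ)
    (u : E → F) (θ : E → ℝ) (c : F) (z : ℝ × E) : ℝ :=
  ∑ α, g (u z.2 + (z.1 * θ z.2) • c) (fderiv ℝ u z.2 (e α) + (z.1 * fderiv ℝ θ z.2 (e α)) • c)
    (fderiv ℝ u z.2 (e α) + (z.1 * fderiv ℝ θ z.2 (e α)) • c)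

variable {ι : Type*} [Fintype ι] {e : ι → E} {g : F → F →L[ℝ] F →L[ℝ] ℝ} {u : E → F}
  {θ : E → ℝ} {c : F} {Ω : Set E} {T : Set F}

theorem contDiffOn_variationDensity (hΩ : IsOpen Ω) (hg : ContDiffOn ℝ ∞ g T)
    (hu : ContDiffOn ℝ ∞ u Ω) (hθ : ContDiff ℝ ∞ θ) {δ : ℝ}
    (hδ : ∀ t ∈ Ioo (-δ) δ, ∀ x ∈ Ω, u x + (t * θ x) • c ∈ T) :
    ContDiffOn ℝ 1 (variationDensity e g u θ c) (Ioo (-δ) δ ×ˢ Ω) := by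
  have hsnd : MapsTo (Prod.snd : ℝ × E → E) (Ioo (-δ) δ ×ˢ Ω) Ω := fun z hz ↦ hz.2
  have h1 : ContDiffOn ℝ 1 (fun z : ℝ × E ↦ u z.2 + (z.1 * θ z.2) • c) (Ioo (-δ) δ ×ˢ Ω) := by
    refine ((hu.of_le (by simp)).comp contDiffOn_snd hsnd).add ?_
    have : ContDiff ℝ 1 θ := hθ.of_le (by simp)
    fun_prop
  have h2 := (hg.of_le (by simp : (1 : ℕ∞ω) ≤ ∞)).comp h1 (fun z hz ↦ hδ z.1 hz.1 z.2 hz.2)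
  refine ContDiffOn.sum fun α _ ↦ ?_
  have hu' : ContDiffOn ℝ 1 (fun z : ℝ × E ↦ fderiv ℝ u z.2 (e α)) (Ioo (-δ) δ ×ˢ Ω) :=
    (((hu.fderiv_of_isOpen hΩ (m := ∞) (by simp)).clm_apply contDiffOn_const).comp
      contDiffOn_snd hsnd).of_le (by simp)
  have hθ' : ContDiff ℝ 1 (fun z : ℝ × E ↦ fderiv ℝ θ z.2 (e α)) :=
    (((hθ.fderiv_right (m := ∞) (by simp)).clm_apply contDiff_const).comp
      contDiff_snd).of_le (by simp)
  have h3 : ContDiffOn ℝ 1 (fun z : ℝ × E ↦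
      fderiv ℝ u z.2 (e α) + (z.1 * fderiv ℝ θ z.2 (e α)) • c) (Ioo (-δ) δ ×ˢ Ω) :=
    hu'.add ((contDiff_fst.mul hθ').smul contDiff_const).contDiffOn
  exact (h2.clm_apply h3).clm_apply h3

set_option synthInstance.maxHeartbeats 200000 in
theorem fderiv_variationDensity (hΩ : IsOpen Ω) (hT : IsOpen T) (hg : ContDiffOn ℝ ∞ g T)
    (hsymm : ∀ y v w, g y v w = g y w v)
    (hu : ContDiffOn ℝ ∞ u Ω) (hθ : ContDiff ℝ ∞ θ) {δ : ℝ} (hδ0 : 0 < δ)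
    (hδ : ∀ t ∈ Ioo (-δ) δ, ∀ x ∈ Ω, u x + (t * θ x) • c ∈ T) {x : E} (hx : x ∈ Ω) :
    fderiv ℝ (variationDensity e g u θ c) (0, x) (1, 0)
      = θ x * ∑ α, fderiv ℝ g (u x) c (fderiv ℝ u x (e α)) (fderiv ℝ u x (e α))
        + ∑ α, fderiv ℝ θ x (e α) * (2 * g (u x) (fderiv ℝ u x (e α)) c) := by
  have h0 : (0 : ℝ) ∈ Ioo (-δ) δ := ⟨by linarith, hδ0⟩
  have h1 : HasFDerivAt (variationDensity e g u θ c)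
      (fderiv ℝ (variationDensity e g u θ c) (0, x)) (0, x) :=
    (((contDiffOn_variationDensity hΩ hg hu hθ hδ).differentiableOn
      one_ne_zero).differentiableAt ((isOpen_Ioo.prod hΩ).mem_nhds ⟨h0, hx⟩)).hasFDerivAt
  have h2 : HasDerivAt (fun s : ℝ ↦ (s, x)) ((1 : ℝ), (0 : E)) 0 :=
    (hasDerivAt_id (0 : ℝ)).prodMk (hasDerivAt_const 0 x)
  have h3 := h1.comp_hasDerivAt (0 : ℝ) h2
  have huT : u x ∈ T := by simpa using hδ 0 h0 x hx
  have hlin : ∀ (p : F) (r : ℝ), HasDerivAt (fun s : ℝ ↦ p + (s * r) • c) (r • c) 0 := by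
    intro p r
    have := (((hasDerivAt_id (0 : ℝ)).mul_const r).smul_const c).const_add p
    simpa using this
  have hgd := ((hg.differentiableOn (by simp)).differentiableAt
    (hT.mem_nhds huT)).hasFDerivAt.hasDerivAt_add_smul (c := c) (θ x)
  have h5 : HasDerivAt (fun s ↦ variationDensity e g u θ c (s, x))
      (∑ α, ((θ x • fderiv ℝ g (u x) c) (fderiv ℝ u x (e α)) (fderiv ℝ u x (e α))
        + g (u x) (fderiv ℝ θ x (e α) • c) (fderiv ℝ u x (e α))
        + g (u x) (fderiv ℝ u x (e α)) (fderiv ℝ θ x (e α) • c))) 0 := by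
    refine HasDerivAt.fun_sum fun α _ ↦ ?_
    have h6 := hlin (fderiv ℝ u x (e α)) (fderiv ℝ θ x (e α))
    have h7 := hgd.bilinear_apply h6 h6
    simp only [zero_mul, zero_smul, add_zero] at h7
    exact h7
  rw [h3.unique h5, Finset.mul_sum, ← Finset.sum_add_distrib]
  refine Finset.sum_congr rfl fun α _ ↦ ?_
  -- Symmetry of g merges the two cross terms, whence the factor 2.
  rw [map_smul (g (u x)), map_smul (g (u x) _), smul_apply, smul_apply, smul_apply, hsymm (u x) c]
  simp only [smul_eq_mul]
  ring

set_option synthInstance.maxHeartbeats 200000 in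
set_option maxHeartbeats 1000000 in
/-- The Euler-Lagrange equation of the energy for a metric `g` depending on the point. -/
theorem eulerLagrange_of_forall_integral_eq_zero [FiniteDimensional ℝ E] [MeasurableSpace E]
    [BorelSpace E] {μ : Measure E} [μ.IsAddHaarMeasure] (hΩ : IsOpen Ω) (hT : IsOpen T)
    (hg : ContDiffOn ℝ ∞ g T) (hsymm : ∀ y v w, g y v w = g y w v)
    (hu : ContDiffOn ℝ ∞ u Ω) (huT : MapsTo u Ω T)
    (H : ∀ θ : E → ℝ, ContDiff ℝ ∞ θ → HasCompactSupport θ → tsupport θ ⊆ Ω → ∀ δ > 0,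
      (∀ t ∈ Ioo (-δ) δ, ∀ x ∈ Ω, u x + (t * θ x) • c ∈ T) →
      ∫ x in tsupport θ, fderiv ℝ (variationDensity e g u θ c) (0, x) (1, 0) ∂μ = 0)
    {x : E} (hx : x ∈ Ω) :
    g (u x) (∑ α, fderiv ℝ (fun y ↦ fderiv ℝ u y (e α)) x (e α)) c
      = ∑ α, (1 / 2 * fderiv ℝ g (u x) c (fderiv ℝ u x (e α)) (fderiv ℝ u x (e α))
          - fderiv ℝ g (u x) (fderiv ℝ u x (e α)) (fderiv ℝ u x (e α)) c) := by
  have hud : ∀ α, ContDiffOn ℝ ∞ (fun y ↦ fderiv ℝ u y (e α)) Ω := fun α ↦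
    (hu.fderiv_of_isOpen hΩ (m := ∞) (by simp)).clm_apply contDiffOn_const
  have hgu : ContDiffOn ℝ ∞ (fun y ↦ g (u y)) Ω := hg.comp hu huT
  have ha : ContinuousOn (fun y ↦ ∑ α, fderiv ℝ g (u y) c (fderiv ℝ u y (e α))
      (fderiv ℝ u y (e α))) Ω :=
    continuousOn_finsetSum _ fun α _ ↦ by
      have h1 : ContDiffOn ℝ ∞ (fun y ↦ fderiv ℝ g (u y) c) Ω :=
        hg.fderiv_comp_apply hT hu huT c
      exact ((h1.clm_apply (hud α)).clm_apply (hud α)).continuousOn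
  have hh : ∀ α, ContDiffOn ℝ 1 (fun y ↦ 2 * g (u y) (fderiv ℝ u y (e α)) c) Ω := fun α ↦
    (contDiffOn_const.mul ((hgu.clm_apply (hud α)).clm_apply contDiffOn_const)).of_le (by simp)
  -- The equation in divergence form: the term ∂_c g(∂_α u, ∂_α u), summed over α, equals the
  -- divergence of 2g(∂_α u, c). Expanding that divergence by the product rule isolates g(Δu, c).
  have key := eq_sum_fderiv_of_forall_integral_eq_zero (μ := μ) e hΩ ha hh
    (fun θ hθ hθc hθs ↦ by
      obtain ⟨δ, hδ0, hδ⟩ := exists_forall_add_smul_mem hT hu.continuousOn huT hθ.continuous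
        hθc hθs c
      rw [← H θ hθ hθc hθs δ hδ0 hδ]
      refine setIntegral_congr_fun hθc.isCompact.measurableSet fun y hy ↦ ?_
      exact (fderiv_variationDensity hΩ hT hg hsymm hu hθ hδ0 hδ (hθs hy)).symm) hx
  have hder : ∀ α, fderiv ℝ (fun y ↦ 2 * g (u y) (fderiv ℝ u y (e α)) c) x (e α)
      = 2 * (fderiv ℝ g (u x) (fderiv ℝ u x (e α)) (fderiv ℝ u x (e α)) c
          + g (u x) (fderiv ℝ (fun y ↦ fderiv ℝ u y (e α)) x (e α)) c) := by
    intro α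
    have h1 : HasFDerivAt u (fderiv ℝ u x) x :=
      ((hu.differentiableOn (by simp)).differentiableAt (hΩ.mem_nhds hx)).hasFDerivAt
    have h2 := ((hg.differentiableOn (by simp)).differentiableAt (hT.mem_nhds (huT hx))).hasFDerivAt
    have h3 : HasFDerivAt (fun y ↦ fderiv ℝ u y (e α))
        (fderiv ℝ (fun y ↦ fderiv ℝ u y (e α)) x) x :=
      (((hud α).differentiableOn (by simp)).differentiableAt (hΩ.mem_nhds hx)).hasFDerivAt
    have h4 := h2.hasDerivAt_comp_line h1 (e α)
    have h5 := (h4.bilinear_apply (h3.hasDerivAt_line (e α)) (hasDerivAt_const (0 : ℝ) c)).const_mul 2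
    have h6 := (((hh α).differentiableOn one_ne_zero).differentiableAt
      (hΩ.mem_nhds hx)).hasFDerivAt.hasDerivAt_line (e α)
    rw [h6.unique h5]
    simp
  simp only [hder, mul_add, Finset.sum_add_distrib, ← Finset.mul_sum] at key
  rw [map_sum, sum_apply, Finset.sum_sub_distrib, ← Finset.mul_sum]
  linarith

end FirstVariation

/-! ### The harmonic map equation in a chart. -/

section EulerLagrange

variable {n : ℕ} {N : Type*} [TopologicalSpace N] [ChartedSpace (EuclideanSpace ℝ (Fin n)) N]
  {ψ : OpenPartialHomeomorph N (EuclideanSpace ℝ (Fin n))}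

theorem contDiffOn_chart_comp {E : Type*} [NormedAddCommGroup E] [NormedSpace ℝ E]
    (hψ : ψ ∈ IsManifold.maximalAtlas (𝓡 n) ∞ N) {φ : E → N} {Ω : Set E}
    (hφ : ContMDiffOn 𝓘(ℝ, E) (𝓡 n) ∞ φ Ω) (hφψ : MapsTo φ Ω ψ.source) :
    ContDiffOn ℝ ∞ (fun x ↦ ψ (φ x)) Ω := by
  rw [← contMDiffOn_iff_contDiffOn]
  exact (contMDiffOn_of_mem_maximalAtlas hψ).comp hφ hφψ

variable [IsManifold (𝓡 n) ∞ N]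
  [RiemannianBundle (fun x : N ↦ TangentSpace (𝓡 n) x)]
  [IsContMDiffRiemannianBundle (𝓡 n) ∞ (EuclideanSpace ℝ (Fin n))
      (fun x : N ↦ TangentSpace (𝓡 n) x)]
  {φ : EuclideanSpace ℝ (Fin 2) → N} {Ω : Set (EuclideanSpace ℝ (Fin 2))}

/-- Linear variations in the chart, pushed to N by `ψ.symm`, are admissible, and their energy
density is `variationDensity`. The energy thus has derivative 0 by criticality and the integral
below by differentiation under the integral sign. -/
theorem IsHarmonicOn.integral_fderiv_variationDensity_eq_zero (hΩ : IsOpen Ω)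
    (hφ : IsHarmonicOn n φ Ω)
    (hψ : ψ ∈ IsManifold.maximalAtlas (𝓡 n) ∞ N) (hφψ : MapsTo φ Ω ψ.source)
    {θ : EuclideanSpace ℝ (Fin 2) → ℝ} (hθ : ContDiff ℝ ∞ θ) (hθc : HasCompactSupport θ)
    (hθs : tsupport θ ⊆ Ω) (c : EuclideanSpace ℝ (Fin n)) {δ : ℝ} (hδ0 : 0 < δ)
    (hδ : ∀ t ∈ Ioo (-δ) δ, ∀ x ∈ Ω, ψ (φ x) + (t * θ x) • c ∈ ψ.target) :
    ∫ x in tsupport θ, fderiv ℝ (variationDensity (fun α ↦ EuclideanSpace.single α (1 : ℝ))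
      (chartMetric ψ) (fun x ↦ ψ (φ x)) θ c) (0, x) (1, 0) = 0 := by
  have hu := contDiffOn_chart_comp hψ hφ.smooth hφψ
  set u : EuclideanSpace ℝ (Fin 2) → EuclideanSpace ℝ (Fin n) := fun x ↦ ψ (φ x) with hu_def
  have hsnd : MapsTo (Prod.snd : ℝ × EuclideanSpace ℝ (Fin 2) → _) (Ioo (-δ) δ ×ˢ Ω) Ω :=
    fun z hz ↦ hz.2
  let Φ : ℝ × EuclideanSpace ℝ (Fin 2) → N := fun z ↦ ψ.symm (u z.2 + (z.1 * θ z.2) • c)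
  have hvar : IsVariation n φ Ω (tsupport θ) δ Φ := by
    refine ⟨?_, fun x hx ↦ ?_, fun t ht x hx ↦ ?_⟩
    · have h1 : ContDiffOn ℝ ∞ (fun z : ℝ × EuclideanSpace ℝ (Fin 2) ↦
          u z.2 + (z.1 * θ z.2) • c) (Ioo (-δ) δ ×ˢ Ω) := by
        refine (hu.comp contDiffOn_snd hsnd).add ?_
        fun_prop
      exact (contMDiffOn_symm_of_mem_maximalAtlas hψ).comp h1.contMDiffOn
        fun z hz ↦ hδ z.1 hz.1 z.2 hz.2
    · simp [Φ, hu_def, ψ.left_inv (hφψ hx)]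
    · simp [Φ, hu_def, ψ.left_inv (hφψ hx.1), image_eq_zero_of_notMem_tsupport hx.2]
  have hcrit := hφ.critical _ hθs hθc.isCompact δ hδ0 Φ hvar
  have hder := hasDerivAt_setIntegral_of_contDiffOn (μ := volume) hδ0 hΩ hθc.isCompact hθs
    (contDiffOn_variationDensity (e := fun α ↦ EuclideanSpace.single α (1 : ℝ)) hΩ
      (contDiffOn_chartMetric hψ) hu hθ hδ)
  refine hder.unique (hcrit.congr_of_eventuallyEq ?_)
  filter_upwards [Ioo_mem_nhds (neg_lt_zero.2 hδ0) hδ0] with t ht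
  refine setIntegral_congr_fun hθc.isCompact.measurableSet fun x hx ↦ ?_
  have hxΩ := hθs hx
  have hud : DifferentiableAt ℝ u x :=
    (hu.differentiableOn (by simp)).differentiableAt (hΩ.mem_nhds hxΩ)
  have hθd : DifferentiableAt ℝ θ x := hθ.differentiable (by simp) x
  have hd : HasFDerivAt (fun y ↦ u y + (t * θ y) • c)
      (fderiv ℝ u x + (t • fderiv ℝ θ x).smulRight c) x :=
    hud.hasFDerivAt.add ((hθd.hasFDerivAt.const_mul t).smul_const c)
  simp only [variationDensity, energyDensity]
  refine Finset.sum_congr rfl fun α _ ↦ ?_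
  rw [pullbackMetric_chart_symm_comp hψ hd.differentiableAt (hδ t ht x hxΩ), hd.fderiv]
  simp

/-- The harmonic map equation in a chart. -/
theorem IsHarmonicOn.chartMetric_laplacian (hΩ : IsOpen Ω) (hφ : IsHarmonicOn n φ Ω)
    (hψ : ψ ∈ IsManifold.maximalAtlas (𝓡 n) ∞ N) (hφψ : MapsTo φ Ω ψ.source)
    {u : EuclideanSpace ℝ (Fin 2) → EuclideanSpace ℝ (Fin n)} (hu_def : u = fun x ↦ ψ (φ x))
    {x : EuclideanSpace ℝ (Fin 2)} (hx : x ∈ Ω) (c : EuclideanSpace ℝ (Fin n)) :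
    chartMetric ψ (u x) (∑ α, fderiv ℝ (fun y ↦ fderiv ℝ u y (EuclideanSpace.single α 1)) x
        (EuclideanSpace.single α 1)) c
      = ∑ α, (1 / 2 * fderiv ℝ (chartMetric ψ) (u x) c (fderiv ℝ u x (EuclideanSpace.single α 1))
            (fderiv ℝ u x (EuclideanSpace.single α 1))
          - fderiv ℝ (chartMetric ψ) (u x) (fderiv ℝ u x (EuclideanSpace.single α 1))
            (fderiv ℝ u x (EuclideanSpace.single α 1)) c) := by
  have hu : ContDiffOn ℝ ∞ u Ω := hu_def ▸ contDiffOn_chart_comp hψ hφ.smooth hφψ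
  have huT : MapsTo u Ω ψ.target := fun x hx ↦ by
    rw [hu_def]; exact ψ.map_source (hφψ hx)
  have hg := contDiffOn_chartMetric hψ
  have hT := ψ.open_target
  exact eulerLagrange_of_forall_integral_eq_zero (μ := volume)
    (e := fun α : Fin 2 ↦ EuclideanSpace.single α (1 : ℝ)) hΩ hT hg (chartMetric_comm ψ) hu huT
    (fun θ hθ hθc hθs δ hδ0 hδ ↦ by
      subst hu_def
      exact hφ.integral_fderiv_variationDensity_eq_zero hΩ hψ hφψ hθ hθc hθs c hδ0 hδ) hx

end EulerLagrange

/-! ### Uniform bounds for the metric on compact sets. -/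

section MetricBounds

theorem ContDiffOn.exists_norm_fderiv_apply_le {F G : Type*}
    [NormedAddCommGroup F] [NormedSpace ℝ F] [NormedAddCommGroup G] [NormedSpace ℝ G]
    {g : F → G} {T Y : Set F} (hg : ContDiffOn ℝ ∞ g T) (hT : IsOpen T) (hY : IsCompact Y)
    (hYT : Y ⊆ T) : ∃ D : ℝ, 0 ≤ D ∧ ∀ y ∈ Y, ∀ a, ‖fderiv ℝ g y a‖ ≤ D * ‖a‖ := by
  obtain ⟨D, hD⟩ := hY.exists_bound_of_continuousOn
    ((hg.continuousOn_fderiv_of_isOpen hT (by simp)).mono hYT)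
  refine ⟨max D 0, le_max_right _ _, fun y hy a ↦ ?_⟩
  exact (fderiv ℝ g y).le_of_opNorm_le ((hD y hy).trans (le_max_left _ _)) a

set_option synthInstance.maxHeartbeats 200000 in
theorem ContDiffOn.exists_abs_fderiv_bilinear_le {F : Type*}
    [NormedAddCommGroup F] [NormedSpace ℝ F]
    {g : F → F →L[ℝ] F →L[ℝ] ℝ} {T Y : Set F} (hg : ContDiffOn ℝ ∞ g T) (hT : IsOpen T)
    (hY : IsCompact Y) (hYT : Y ⊆ T) :
    ∃ D : ℝ, 0 ≤ D ∧ ∀ y ∈ Y, ∀ a b c, |fderiv ℝ g y a b c| ≤ D * ‖a‖ * ‖b‖ * ‖c‖ := by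
  obtain ⟨D, hD0, hD⟩ := hg.exists_norm_fderiv_apply_le hT hY hYT
  refine ⟨D, hD0, fun y hy a b c ↦ ?_⟩
  have h1 := hD y hy a
  have h2 : ‖fderiv ℝ g y a b c‖ ≤ ‖fderiv ℝ g y a b‖ * ‖c‖ := (fderiv ℝ g y a b).le_opNorm c
  refine h2.trans ?_
  have h3 := (fderiv ℝ g y a).le_of_opNorm_le h1 b
  exact mul_le_mul_of_nonneg_right h3 (norm_nonneg c)

/-- Compactness of Y times the unit sphere, then homogeneity. The form of the minimum principle used
also covers an empty sphere. -/
theorem exists_pos_mul_norm_sq_le {F : Type*} [NormedAddCommGroup F] [NormedSpace ℝ F]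
    [FiniteDimensional ℝ F] {g : F → F →L[ℝ] F →L[ℝ] ℝ} {Y : Set F} (hY : IsCompact Y)
    (hg : ContinuousOn g Y) (hpos : ∀ y ∈ Y, ∀ v, v ≠ 0 → 0 < g y v v) :
    ∃ m > 0, ∀ y ∈ Y, ∀ v, m * ‖v‖ ^ 2 ≤ g y v v := by
  have hc : ContinuousOn (fun z : F × F ↦ g z.1 z.2 z.2) (Y ×ˢ sphere 0 1) := by
    have h1 : ContinuousOn (fun z : F × F ↦ g z.1) (Y ×ˢ sphere 0 1) :=
      hg.comp continuousOn_fst fun z hz ↦ hz.1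
    exact (h1.clm_apply continuousOn_snd).clm_apply continuousOn_snd
  obtain ⟨m, hm0, hm⟩ := (hY.prod (isCompact_sphere 0 1)).exists_forall_le' hc
    (a := 0) (fun z hz ↦ hpos z.1 hz.1 z.2 (ne_zero_of_mem_unit_sphere ⟨z.2, hz.2⟩))
  refine ⟨m, hm0, fun y hy v ↦ ?_⟩
  rcases eq_or_ne v 0 with rfl | hv
  · simp
  have hv' : 0 < ‖v‖ := norm_pos_iff.2 hv
  have h1 := hm (y, ‖v‖⁻¹ • v) ⟨hy, by simp [norm_smul, hv'.ne']⟩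
  simp only [map_smul, smul_apply, smul_eq_mul] at h1
  calc m * ‖v‖ ^ 2 ≤ (‖v‖⁻¹ * (‖v‖⁻¹ * g y v v)) * ‖v‖ ^ 2 := by gcongr
    _ = g y v v := by field_simp

theorem exists_le_mul_norm_sq {F : Type*} [NormedAddCommGroup F] [NormedSpace ℝ F]
    [FiniteDimensional ℝ F] {g : F → F →L[ℝ] F →L[ℝ] ℝ} {Y : Set F} (hY : IsCompact Y)
    (hg : ContinuousOn g Y) : ∃ M ≥ 0, ∀ y ∈ Y, ∀ v, g y v v ≤ M * ‖v‖ ^ 2 := by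
  have hc : ContinuousOn (fun z : F × F ↦ g z.1 z.2 z.2) (Y ×ˢ sphere 0 1) := by
    have h1 : ContinuousOn (fun z : F × F ↦ g z.1) (Y ×ˢ sphere 0 1) :=
      hg.comp continuousOn_fst fun z hz ↦ hz.1
    exact (h1.clm_apply continuousOn_snd).clm_apply continuousOn_snd
  obtain ⟨M, hM⟩ := (hY.prod (isCompact_sphere 0 1)).exists_bound_of_continuousOn hc
  refine ⟨max M 0, le_max_right _ _, fun y hy v ↦ ?_⟩
  rcases eq_or_ne v 0 with rfl | hv
  · simp
  have hv' : 0 < ‖v‖ := norm_pos_iff.2 hv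
  have h1 := ((le_abs_self _).trans (hM (y, ‖v‖⁻¹ • v) ⟨hy, by simp [norm_smul, hv'.ne']⟩)).trans
    (le_max_left M 0)
  simp only [map_smul, smul_apply, smul_eq_mul] at h1
  calc g y v v = (‖v‖⁻¹ * (‖v‖⁻¹ * g y v v)) * ‖v‖ ^ 2 := by field_simp
    _ ≤ max M 0 * ‖v‖ ^ 2 := by gcongr

end MetricBounds

/-! ### The differential inequality |Δu| ≤ C|∇u|. -/

section EulerLagrangeBound

variable {n : ℕ} {N : Type*} [TopologicalSpace N] [ChartedSpace (EuclideanSpace ℝ (Fin n)) N]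
  {ψ : OpenPartialHomeomorph N (EuclideanSpace ℝ (Fin n))} [IsManifold (𝓡 n) ∞ N]
  [RiemannianBundle (fun x : N ↦ TangentSpace (𝓡 n) x)]
  [IsContMDiffRiemannianBundle (𝓡 n) ∞ (EuclideanSpace ℝ (Fin n))
      (fun x : N ↦ TangentSpace (𝓡 n) x)]
  {φ : EuclideanSpace ℝ (Fin 2) → N} {Ω : Set (EuclideanSpace ℝ (Fin 2))}

/-- On compact sets, the Laplacian of a harmonic map in a chart is bounded by its gradient. -/
theorem IsHarmonicOn.exists_norm_laplacian_sq_le (hΩ : IsOpen Ω) (hφ : IsHarmonicOn n φ Ω)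
    (hψ : ψ ∈ IsManifold.maximalAtlas (𝓡 n) ∞ N) (hφψ : MapsTo φ Ω ψ.source)
    {u : EuclideanSpace ℝ (Fin 2) → EuclideanSpace ℝ (Fin n)} (hu_def : u = fun x ↦ ψ (φ x))
    {K : Set (EuclideanSpace ℝ (Fin 2))} (hK : IsCompact K) (hKΩ : K ⊆ Ω) :
    ∃ C : ℝ, ∀ x ∈ K,
      ‖∑ α, fderiv ℝ (fun y ↦ fderiv ℝ u y (EuclideanSpace.single α 1)) x
        (EuclideanSpace.single α 1)‖ ^ 2
      ≤ C * ∑ α, ‖fderiv ℝ u x (EuclideanSpace.single α 1)‖ ^ 2 := by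
  have hu : ContDiffOn ℝ ∞ u Ω := hu_def ▸ contDiffOn_chart_comp hψ hφ.smooth hφψ
  have huT : MapsTo u Ω ψ.target := fun x hx ↦ by
    rw [hu_def]; exact ψ.map_source (hφψ hx)
  have hg := contDiffOn_chartMetric hψ
  have hY : IsCompact (u '' K) := hK.image_of_continuousOn (hu.continuousOn.mono hKΩ)
  have hYT : u '' K ⊆ ψ.target := image_subset_iff.2 fun x hx ↦ huT (hKΩ hx)
  obtain ⟨m, hm0, hm⟩ := exists_pos_mul_norm_sq_le hY (hg.continuousOn.mono hYT)
    fun y hy v hv ↦ chartMetric_self_pos hψ (hYT hy) hv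
  obtain ⟨D, hD0, hD'⟩ := hg.exists_abs_fderiv_bilinear_le ψ.open_target hY hYT
  have hcont : ContinuousOn (fun x ↦ ∑ α, ‖fderiv ℝ u x (EuclideanSpace.single α 1)‖ ^ 2) K :=
    continuousOn_finsetSum _ fun α _ ↦
      (((hu.continuousOn_fderiv_of_isOpen hΩ (by simp)).mono hKΩ).clm_apply
        continuousOn_const).norm.pow 2
  obtain ⟨B, hB⟩ := hK.exists_bound_of_continuousOn hcont
  -- Testing the equation with c = L = Δu gives m|L|² ≤ (1/2 + 1) D |L| S, so |L| ≤ (3/2)(D/m) S.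
  -- After squaring, one factor S is bounded by its maximum B on K; this makes the quadratic
  -- nonlinearity linear.
  refine ⟨(3 / 2 * D / m) ^ 2 * B, fun x hx ↦ ?_⟩
  have hEL := hφ.chartMetric_laplacian hΩ hψ hφψ hu_def (hKΩ hx)
  set L := ∑ α, fderiv ℝ (fun y ↦ fderiv ℝ u y (EuclideanSpace.single α 1)) x
        (EuclideanSpace.single α 1) with hL
  set S := ∑ α, ‖fderiv ℝ u x (EuclideanSpace.single α 1)‖ ^ 2 with hS
  have hS0 : 0 ≤ S := Finset.sum_nonneg fun _ _ ↦ by positivity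
  have hux : u x ∈ u '' K := mem_image_of_mem _ hx
  have hv : ∀ v, 1 / 2 * fderiv ℝ (chartMetric ψ) (u x) L v v
      - fderiv ℝ (chartMetric ψ) (u x) v v L ≤ 3 / 2 * D * ‖L‖ * ‖v‖ ^ 2 := by
    intro v
    have ha := (abs_le.1 (hD' (u x) hux L v v)).2
    have hb := (abs_le.1 (hD' (u x) hux v v L)).1
    linarith [show 3 / 2 * D * ‖L‖ * ‖v‖ ^ 2 = 1 / 2 * (D * ‖L‖ * ‖v‖ * ‖v‖)
      + D * ‖v‖ * ‖v‖ * ‖L‖ by ring]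
  have h1 : m * ‖L‖ ^ 2 ≤ 3 / 2 * D * ‖L‖ * S := by
    have h0 : chartMetric ψ (u x) L L ≤ ∑ α : Fin 2, 3 / 2 * D * ‖L‖
        * ‖fderiv ℝ u x (EuclideanSpace.single α 1)‖ ^ 2 :=
      (hEL L).trans_le (Finset.sum_le_sum fun α _ ↦ hv (fderiv ℝ u x (EuclideanSpace.single α 1)))
    rw [← Finset.mul_sum] at h0
    exact (hm _ hux L).trans h0
  have hSB : S ≤ B := (le_abs_self _).trans (hB x hx)
  clear_value S L
  clear hEL hv
  have h2 : ‖L‖ ≤ 3 / 2 * D / m * S := by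
    rcases (norm_nonneg L).eq_or_lt with h0 | h0
    · rw [← h0]; positivity
    · rw [div_mul_eq_mul_div, le_div_iff₀ hm0]
      nlinarith
  calc ‖L‖ ^ 2 ≤ (3 / 2 * D / m * S) ^ 2 := by gcongr
    _ = (3 / 2 * D / m) ^ 2 * S * S := by ring
    _ ≤ (3 / 2 * D / m) ^ 2 * B * S := by gcongr

end EulerLagrangeBound

/-! ### Comparison of the Riemannian distance with chart coordinates. -/

section RiemannianDistance

/-- The two norms live on the tangent spaces at f x and g x, which are equal only propositionally;
the underlying model vectors agree, so the base point can be transported. -/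
theorem norm_mfderiv_congr {n : ℕ} {N : Type*} [TopologicalSpace N]
    [ChartedSpace (EuclideanSpace ℝ (Fin n)) N]
    [RiemannianBundle (fun x : N ↦ TangentSpace (𝓡 n) x)] {E : Type*} [NormedAddCommGroup E]
    [NormedSpace ℝ E] {f g : E → N} {x : E} (h : f =ᶠ[nhds x] g) (a : E) :
    ‖mfderiv 𝓘(ℝ, E) (𝓡 n) f x a‖ = ‖mfderiv 𝓘(ℝ, E) (𝓡 n) g x a‖ := by
  have hq : ∀ (q q' : N) (_ : q = q') (v : EuclideanSpace ℝ (Fin n)),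
      norm (E := TangentSpace (𝓡 n) q) v = norm (E := TangentSpace (𝓡 n) q') v := by
    rintro q _ rfl v
    rfl
  have h2 := congr($(h.mfderiv_eq (I := 𝓘(ℝ, E)) (I' := 𝓡 n)) a)
  exact (hq _ _ h.eq_of_nhds _).trans
    (congrArg (fun v : EuclideanSpace ℝ (Fin n) ↦ norm (E := TangentSpace (𝓡 n) (g x)) v) h2)

variable {n : ℕ} {N : Type*} [MetricSpace N] [ChartedSpace (EuclideanSpace ℝ (Fin n)) N]
  [RiemannianBundle (fun x : N ↦ TangentSpace (𝓡 n) x)]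
  [IsRiemannianManifold (𝓡 n) N]
  {ψ : OpenPartialHomeomorph N (EuclideanSpace ℝ (Fin n))}

/-- A map which is Lipschitz along a segment in a chart is Lipschitz for the Riemannian distance. -/
theorem dist_chart_symm_le {E : Type*} [NormedAddCommGroup E] [NormedSpace ℝ E]
    (hψ : ψ ∈ IsManifold.maximalAtlas (𝓡 n) ∞ N) {u : E → EuclideanSpace ℝ (Fin n)} {Ω : Set E}
    (hΩ : IsOpen Ω) (hu : ContDiffOn ℝ ∞ u Ω) (huT : MapsTo u Ω ψ.target) {x y : E}
    (hxy : segment ℝ x y ⊆ Ω) {M A : ℝ} (hM0 : 0 ≤ M) (hA0 : 0 ≤ A)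
    (hM : ∀ z ∈ segment ℝ x y, ∀ v, chartMetric ψ (u z) v v ≤ M ^ 2 * ‖v‖ ^ 2)
    (hA : ∀ z ∈ segment ℝ x y, ‖fderiv ℝ u z‖ ≤ A) :
    dist (ψ.symm (u x)) (ψ.symm (u y)) ≤ M * A * ‖y - x‖ := by
  let l : ℝ → E := fun t ↦ x + t • (y - x)
  have hl : ∀ t ∈ Icc (0 : ℝ) 1, l t ∈ segment ℝ x y := fun t ht ↦ by
    rw [segment_eq_image']; exact ⟨t, ht, rfl⟩
  have hld : ∀ t, HasDerivAt l (y - x) t := fun t ↦ by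
    simpa [l] using ((hasDerivAt_id t).smul_const (y - x)).const_add x
  have hlc : ContDiff ℝ ∞ l := by fun_prop
  have hul : ContDiffOn ℝ ∞ (fun t ↦ u (l t)) (Icc 0 1) :=
    hu.comp hlc.contDiffOn fun t ht ↦ hxy (hl t ht)
  have hγ : ContMDiffOn 𝓘(ℝ, ℝ) (𝓡 n) 1 (fun t ↦ ψ.symm (u (l t))) (Icc 0 1) :=
    ((contMDiffOn_symm_of_mem_maximalAtlas hψ).comp hul.contMDiffOn
      fun t ht ↦ huT (hxy (hl t ht))).of_le (by simp)
  have hle := riemannianEDist_le_pathELength hγ (x := ψ.symm (u x)) (y := ψ.symm (u y))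
    (by simp [l]) (by simp [l]) zero_le_one
  rw [← IsRiemannianManifold.out (I := 𝓡 n), pathELength_eq_lintegral_mfderiv_Icc] at hle
  have hbound : ∫⁻ t in Icc (0 : ℝ) 1, ‖mfderiv 𝓘(ℝ, ℝ) (𝓡 n) (fun t ↦ ψ.symm (u (l t))) t 1‖ₑ
      ≤ ∫⁻ t in Icc (0 : ℝ) 1, ENNReal.ofReal (M * A * ‖y - x‖) := by
    refine setLIntegral_mono' measurableSet_Icc fun t ht ↦ ?_
    rw [← ofReal_norm]
    apply ENNReal.ofReal_le_ofReal
    have hz := hl t ht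
    have hud : HasFDerivAt u (fderiv ℝ u (l t)) (l t) :=
      ((hu.differentiableOn (by simp)).differentiableAt (hΩ.mem_nhds (hxy hz))).hasFDerivAt
    have hd : HasDerivAt (fun s ↦ u (l s)) (fderiv ℝ u (l t) (y - x)) t :=
      hud.comp_hasDerivAt t (hld t)
    have hsq := norm_sq_mfderiv_chart_symm_comp hψ hd.differentiableAt (huT (hxy hz)) 1
    refine le_of_sq_le_sq (hsq.trans_le ((hM _ hz _).trans ?_)) (by positivity)
    rw [fderiv_apply_one_eq_deriv, hd.deriv, ← mul_pow, mul_assoc]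
    gcongr
    exact (fderiv ℝ u (l t)).le_of_opNorm_le (hA _ hz) _
  have hfin := hle.trans hbound
  rw [setLIntegral_const, Real.volume_Icc, sub_zero, ENNReal.ofReal_one, mul_one,
    edist_dist] at hfin
  exact (ENNReal.ofReal_le_ofReal_iff (by positivity)).1 hfin

variable [IsManifold (𝓡 n) ∞ N] [IsContMDiffRiemannianBundle (𝓡 n) ∞ (EuclideanSpace ℝ (Fin n))
      (fun x : N ↦ TangentSpace (𝓡 n) x)]

/-- The coordinates of a chart are locally controlled by the Riemannian distance. -/
theorem eventually_norm_chart_sub_le_dist (hψ : ψ ∈ IsManifold.maximalAtlas (𝓡 n) ∞ N) {p : N}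
    (hp : p ∈ ψ.source) : ∃ C > 0, ∀ᶠ q in nhds p, ‖ψ q - ψ p‖ ≤ C * dist p q := by
  obtain ⟨r, hr, hrT⟩ := nhds_basis_closedBall.mem_iff.1
    (ψ.open_target.mem_nhds (ψ.map_source hp))
  obtain ⟨m, hm0, hm⟩ := exists_pos_mul_norm_sq_le (isCompact_closedBall (ψ p) r)
    ((contDiffOn_chartMetric hψ).continuousOn.mono hrT)
    fun y hy v hv ↦ chartMetric_self_pos hψ (hrT hy) hv
  have hs : ψ.source ∩ ψ ⁻¹' closedBall (ψ p) r ∈ nhds p :=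
    Filter.inter_mem (ψ.open_source.mem_nhds hp)
      ((ψ.continuousAt hp).preimage_mem_nhds (closedBall_mem_nhds _ hr))
  -- Within distance κ of p the chart is defined and the lower bound m for the metric holds.
  obtain ⟨κ, hκ0, hκ⟩ := EMetric.mem_nhds_iff.1 hs
  refine ⟨(Real.sqrt m)⁻¹, by positivity, ?_⟩
  filter_upwards [eball_mem_nhds p hκ0] with q hq
  have hqκ : edist p q < κ := by rwa [edist_comm]
  have hmain : ‖ψ q - ψ p‖ₑ ≤ ENNReal.ofReal (Real.sqrt m)⁻¹ * edist p q := by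
    have hlt : ∀ L, edist p q < L → L < κ →
        ‖ψ q - ψ p‖ₑ ≤ ENNReal.ofReal (Real.sqrt m)⁻¹ * L := by
      intro L hL hLκ
      rw [IsRiemannianManifold.out (I := 𝓡 n)] at hL
      obtain ⟨γ, hγ0, hγ1, hγ, hγL, -⟩ :=
        exists_lt_locally_constant_of_riemannianEDist_lt hL zero_lt_one
      -- A curve from p of length less than κ cannot leave the κ-ball, since each initial arc is no
      -- longer than the whole.
      have hmem : ∀ t ∈ Icc (0 : ℝ) 1, γ t ∈ ψ.source ∩ ψ ⁻¹' closedBall (ψ p) r := by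
        intro t ht
        apply hκ
        rw [mem_eball, edist_comm, IsRiemannianManifold.out (I := 𝓡 n)]
        refine (riemannianEDist_le_pathELength hγ.contMDiffOn hγ0 rfl ht.1).trans_lt ?_
        exact ((pathELength_mono le_rfl ht.2).trans_lt hγL).trans hLκ
      have hO : IsOpen (γ ⁻¹' ψ.source) := ψ.open_source.preimage hγ.continuous
      have hv : ContDiffOn ℝ 1 (fun t ↦ ψ (γ t)) (γ ⁻¹' ψ.source) := by
        rw [← contMDiffOn_iff_contDiffOn]
        exact ((contMDiffOn_of_mem_maximalAtlas hψ).of_le (by simp)).comp hγ.contMDiffOn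
          fun t ht ↦ ht
      have h1 := enorm_sub_le_lintegral_deriv_of_contDiffOn_Icc
        (hv.mono fun t ht ↦ (hmem t ht).1) zero_le_one
      rw [hγ0, hγ1] at h1
      refine h1.trans ?_
      calc ∫⁻ t in Icc (0 : ℝ) 1, ‖deriv (fun t ↦ ψ (γ t)) t‖ₑ
          ≤ ∫⁻ t in Icc (0 : ℝ) 1, ENNReal.ofReal (Real.sqrt m)⁻¹
              * ‖mfderiv 𝓘(ℝ, ℝ) (𝓡 n) γ t 1‖ₑ := by
            refine setLIntegral_mono' measurableSet_Icc fun t ht ↦ ?_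
            rw [← ofReal_norm, ← ofReal_norm, ← ENNReal.ofReal_mul (by positivity)]
            apply ENNReal.ofReal_le_ofReal
            have hts := (hmem t ht).1
            have hvd : DifferentiableAt ℝ (fun t ↦ ψ (γ t)) t :=
              (hv.differentiableOn one_ne_zero).differentiableAt (hO.mem_nhds hts)
            have hsq := norm_sq_mfderiv_chart_symm_comp hψ hvd (ψ.map_source hts) 1
            have hev : (fun z ↦ ψ.symm (ψ (γ z))) =ᶠ[nhds t] γ := by
              filter_upwards [hO.mem_nhds hts] with z hz using ψ.left_inv hz
            have hlow := hm _ (hmem t ht).2 (fderiv ℝ (fun t ↦ ψ (γ t)) t 1)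
            rw [← hsq, fderiv_apply_one_eq_deriv] at hlow
            have hnorm : ‖mfderiv 𝓘(ℝ, ℝ) (𝓡 n) (fun z ↦ ψ.symm (ψ (γ z))) t 1‖
                = ‖mfderiv 𝓘(ℝ, ℝ) (𝓡 n) γ t 1‖ := norm_mfderiv_congr hev 1
            replace hlow := hlow.trans_eq (congrArg (· ^ 2) hnorm)
            rw [inv_mul_eq_div, le_div_iff₀ (Real.sqrt_pos.2 hm0)]
            refine le_of_sq_le_sq ?_ (norm_nonneg _)
            rw [mul_pow, Real.sq_sqrt hm0.le, mul_comm]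
            exact hlow
        _ = ENNReal.ofReal (Real.sqrt m)⁻¹ * pathELength (𝓡 n) γ 0 1 := by
            rw [lintegral_const_mul' _ _ ENNReal.ofReal_ne_top,
              pathELength_eq_lintegral_mfderiv_Icc]
        _ ≤ ENNReal.ofReal (Real.sqrt m)⁻¹ * L := by gcongr
    have hc : 0 < ENNReal.ofReal (Real.sqrt m)⁻¹ := by
      rw [ENNReal.ofReal_pos]; positivity
    rw [mul_comm, ← ENNReal.div_le_iff hc.ne' ENNReal.ofReal_ne_top]
    refine le_of_forall_gt_imp_ge_of_dense fun L hL ↦ ?_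
    -- Lengths L ≥ κ are reduced to a shorter length L' between the distance and κ.
    rcases lt_or_ge L κ with h | h
    · rw [ENNReal.div_le_iff hc.ne' ENNReal.ofReal_ne_top, mul_comm]
      exact hlt L hL h
    · obtain ⟨L', hL', hL'κ⟩ := exists_between hqκ
      refine le_trans ?_ (hL'κ.le.trans h)
      rw [ENNReal.div_le_iff hc.ne' ENNReal.ofReal_ne_top, mul_comm]
      exact hlt L' hL' hL'κ
  rw [← ofReal_norm, edist_dist, ← ENNReal.ofReal_mul (by positivity)] at hmain
  exact (ENNReal.ofReal_le_ofReal_iff (by positivity)).1 hmain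

end RiemannianDistance

/-! ### Carleman estimates for the Cauchy-Riemann operator. -/

section Carleman

/-- A Carleman estimate for the Cauchy-Riemann operator with weight `exp (c |x|² / 2)`, for the
real and imaginary parts `a`, `b` of a compactly supported function on the plane. -/
theorem carleman_cauchyRiemann_real {a b : EuclideanSpace ℝ (Fin 2) → ℝ} (ha : ContDiff ℝ 2 a)
    (hb : ContDiff ℝ 2 b) (has : HasCompactSupport a) (hbs : HasCompactSupport b) (c : ℝ) :
    4 * c * ∫ x, (a x ^ 2 + b x ^ 2) ≤
      ∫ x, ((fderiv ℝ a x (EuclideanSpace.single 0 1) - fderiv ℝ b x (EuclideanSpace.single 1 1)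
          - c * (x 0 * a x - x 1 * b x)) ^ 2
        + (fderiv ℝ a x (EuclideanSpace.single 1 1) + fderiv ℝ b x (EuclideanSpace.single 0 1)
          - c * (x 0 * b x + x 1 * a x)) ^ 2) := by
  set e0 : EuclideanSpace ℝ (Fin 2) := EuclideanSpace.single 0 1 with he0
  set e1 : EuclideanSpace ℝ (Fin 2) := EuclideanSpace.single 1 1 with he1
  have hda : ∀ v, ContDiff ℝ 1 fun x ↦ fderiv ℝ a x v := fun v ↦
    (ha.fderiv_right (m := 1) (by norm_num)).clm_apply contDiff_const
  have hdb : ∀ v, ContDiff ℝ 1 fun x ↦ fderiv ℝ b x v := fun v ↦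
    (hb.fderiv_right (m := 1) (by norm_num)).clm_apply contDiff_const
  have hdas : ∀ v, HasCompactSupport fun x ↦ fderiv ℝ a x v := fun v ↦ has.fderiv_apply ℝ v
  have hdbs : ∀ v, HasCompactSupport fun x ↦ fderiv ℝ b x v := fun v ↦ hbs.fderiv_apply ℝ v
  have ha1 : ContDiff ℝ 1 a := ha.of_le (by norm_num)
  have hb1 : ContDiff ℝ 1 b := hb.of_le (by norm_num)
  have hx : ∀ i : Fin 2, ContDiff ℝ 1 fun x : EuclideanSpace ℝ (Fin 2) ↦ x i := fun i ↦ by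
    fun_prop
  -- Let f = a + ib, Df = 2∂f/∂z̄ - czf, and let D* be the formal adjoint of D. The commutator D*D -
  -- DD* equals 4c, and pointwise |Df|² = |D*f|² + 4c|f|² + div h with h = (h0, h1). The divergence
  -- integrates to zero and |D*f|² is dropped.
  let h0 : EuclideanSpace ℝ (Fin 2) → ℝ := fun x ↦
    -4 * (a x * fderiv ℝ b x e1) + -2 * c * (x 0 * (a x ^ 2 + b x ^ 2))
  let h1 : EuclideanSpace ℝ (Fin 2) → ℝ := fun x ↦
    4 * (a x * fderiv ℝ b x e0) + -2 * c * (x 1 * (a x ^ 2 + b x ^ 2))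
  have hsq : HasCompactSupport fun x ↦ a x ^ 2 + b x ^ 2 := by
    simp only [sq]
    exact has.mul_right.add hbs.mul_right
  have hh0 : ContDiff ℝ 1 h0 := (contDiff_const.mul (ha1.mul (hdb e1))).add
    (contDiff_const.mul ((hx 0).mul ((ha1.pow 2).add (hb1.pow 2))))
  have hh1 : ContDiff ℝ 1 h1 := (contDiff_const.mul (ha1.mul (hdb e0))).add
    (contDiff_const.mul ((hx 1).mul ((ha1.pow 2).add (hb1.pow 2))))
  have hh0s : HasCompactSupport h0 := (has.mul_right.mul_left).add (hsq.mul_left.mul_left)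
  have hh1s : HasCompactSupport h1 := (has.mul_right.mul_left).add (hsq.mul_left.mul_left)
  have hI0 := integral_fderiv_apply_eq_zero (μ := volume) hh0 hh0s e0
  have hI1 := integral_fderiv_apply_eq_zero (μ := volume) hh1 hh1s e1
  have hi0 : Integrable fun x ↦ fderiv ℝ h0 x e0 :=
    ((hh0.continuous_fderiv one_ne_zero).clm_apply
      continuous_const).integrable_of_hasCompactSupport (hh0s.fderiv_apply ℝ e0)
  have hi1 : Integrable fun x ↦ fderiv ℝ h1 x e1 :=
    ((hh1.continuous_fderiv one_ne_zero).clm_apply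
      continuous_const).integrable_of_hasCompactSupport (hh1s.fderiv_apply ℝ e1)
  have hi01 : Integrable fun x ↦ fderiv ℝ h0 x e0 + fderiv ℝ h1 x e1 := hi0.add hi1
  have hisq : Integrable fun x ↦ a x ^ 2 + b x ^ 2 :=
    ((ha.continuous.pow 2).add (hb.continuous.pow 2)).integrable_of_hasCompactSupport hsq
  have hx' : ∀ (i : Fin 2) (x v : EuclideanSpace ℝ (Fin 2)),
      fderiv ℝ (fun x : EuclideanSpace ℝ (Fin 2) ↦ x i) x v = v i := fun i x v ↦ by
    have : HasFDerivAt (fun x : EuclideanSpace ℝ (Fin 2) ↦ x i)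
      (EuclideanSpace.proj i : EuclideanSpace ℝ (Fin 2) →L[ℝ] ℝ) x :=
      (EuclideanSpace.proj i : EuclideanSpace ℝ (Fin 2) →L[ℝ] ℝ).hasFDerivAt
    rw [this.fderiv]; rfl
  have hdiv : ∀ (i : Fin 2) (k : ℝ) (w v x : EuclideanSpace ℝ (Fin 2)), fderiv ℝ (fun x ↦
      k * (a x * fderiv ℝ b x w) + -2 * c * (x i * (a x ^ 2 + b x ^ 2))) x v
      = k * (fderiv ℝ a x v * fderiv ℝ b x w + a x * fderiv ℝ (fun x ↦ fderiv ℝ b x w) x v)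
        - 2 * c * (v i * (a x ^ 2 + b x ^ 2)
          + x i * (2 * a x * fderiv ℝ a x v + 2 * b x * fderiv ℝ b x v)) := by
    intro i k w v x
    have da := (ha1.differentiable one_ne_zero x).hasFDerivAt
    have db := (hb1.differentiable one_ne_zero x).hasFDerivAt
    have ddb := ((hdb w).differentiable one_ne_zero x).hasFDerivAt
    have dx := ((hx i).differentiable one_ne_zero x).hasFDerivAt
    have := ((da.mul ddb).const_mul k).add ((dx.mul ((da.pow 2).add (db.pow 2))).const_mul (-2 * c))
    have h2 := this.fderiv
    have h3 := congr($h2 v)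
    refine Eq.trans ?_ (h3.trans ?_)
    · rfl
    · simp [hx']
      ring
  have hsymm : ∀ x, fderiv ℝ (fun x ↦ fderiv ℝ b x e1) x e0
      = fderiv ℝ (fun x ↦ fderiv ℝ b x e0) x e1 := by
    intro x
    have hd : DifferentiableAt ℝ (fderiv ℝ b) x :=
      (hb.fderiv_right (m := 1) (by norm_num)).differentiable one_ne_zero x
    have h2 : ∀ v w, fderiv ℝ (fun x ↦ fderiv ℝ b x v) x w = fderiv ℝ (fderiv ℝ b) x w v := by
      intro v w
      rw [fderiv_clm_apply hd (differentiableAt_const v)]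
      simp
    rw [h2, h2]
    exact (hb.contDiffAt.isSymmSndFDerivAt (by simp)).eq e0 e1
  have e00 : e0 0 = 1 := by simp [he0]
  have e11 : e1 1 = 1 := by simp [he1]
  calc 4 * c * ∫ x, (a x ^ 2 + b x ^ 2)
      = ∫ x, (4 * c * (a x ^ 2 + b x ^ 2) + (fderiv ℝ h0 x e0 + fderiv ℝ h1 x e1)) := by
        rw [integral_add (hisq.const_mul _) hi01, integral_add hi0 hi1, hI0, hI1,
          integral_const_mul]
        ring
    _ ≤ _ := by
        refine integral_mono ((hisq.const_mul _).add (hi0.add hi1)) ?_ fun x ↦ ?_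
        · refine Continuous.integrable_of_hasCompactSupport ?_ ?_
          · have := fun v ↦ (hda v).continuous
            have := fun v ↦ (hdb v).continuous
            have := ha.continuous
            have := hb.continuous
            fun_prop
          · have hA : HasCompactSupport fun x : EuclideanSpace ℝ (Fin 2) ↦
                fderiv ℝ a x e0 - fderiv ℝ b x e1 - c * (x 0 * a x - x 1 * b x) :=
              ((hdas e0).sub (hdbs e1)).sub ((has.mul_left.sub hbs.mul_left).mul_left)
            have hB : HasCompactSupport fun x : EuclideanSpace ℝ (Fin 2) ↦
                fderiv ℝ a x e1 + fderiv ℝ b x e0 - c * (x 0 * b x + x 1 * a x) :=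
              ((hdas e1).add (hdbs e0)).sub ((hbs.mul_left.add has.mul_left).mul_left)
            simp only [sq]
            exact hA.mul_right.add hB.mul_right
        · simp only [h0, h1]
          rw [hdiv 0 (-4) e1 e0 x, hdiv 1 4 e0 e1 x, hsymm x, e00, e11]
          -- These two squares add up to |D*f|².
          nlinarith [sq_nonneg (fderiv ℝ a x e0 + fderiv ℝ b x e1 + c * (x 0 * a x + x 1 * b x)),
            sq_nonneg (fderiv ℝ b x e0 - fderiv ℝ a x e1 + c * (x 0 * b x - x 1 * a x))]

/-- The plane as the complex line. -/
noncomputable def planeToComplex : EuclideanSpace ℝ (Fin 2) →L[ℝ] ℂ :=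
  (EuclideanSpace.proj 0).smulRight (1 : ℂ) + (EuclideanSpace.proj 1).smulRight Complex.I

theorem planeToComplex_apply (x : EuclideanSpace ℝ (Fin 2)) :
    planeToComplex x = x 0 + x 1 * Complex.I := by
  simp [planeToComplex]

theorem norm_planeToComplex (x : EuclideanSpace ℝ (Fin 2)) : ‖planeToComplex x‖ = ‖x‖ := by
  rw [planeToComplex_apply, Complex.norm_add_mul_I, EuclideanSpace.norm_eq]
  simp

/-- Twice the Cauchy-Riemann operator `∂/∂z̄`. -/
noncomputable def dbar (f : EuclideanSpace ℝ (Fin 2) → ℂ) (x : EuclideanSpace ℝ (Fin 2)) : ℂ :=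
  fderiv ℝ f x (EuclideanSpace.single 0 1) + Complex.I * fderiv ℝ f x (EuclideanSpace.single 1 1)

theorem dbar_mul {f g : EuclideanSpace ℝ (Fin 2) → ℂ} {x : EuclideanSpace ℝ (Fin 2)}
    (hf : DifferentiableAt ℝ f x) (hg : DifferentiableAt ℝ g x) :
    dbar (fun y ↦ f y * g y) x = f x * dbar g x + dbar f x * g x := by
  simp only [dbar, fderiv_fun_mul hf hg, add_apply, smul_apply, smul_eq_mul]
  ring

theorem dbar_comp_planeToComplex {h : ℂ → ℂ} {x : EuclideanSpace ℝ (Fin 2)}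
    (hh : DifferentiableAt ℂ h (planeToComplex x)) : dbar (fun y ↦ h (planeToComplex y)) x = 0 := by
  have h1 : HasFDerivAt (fun y ↦ h (planeToComplex y)) _ x :=
    (hh.hasDerivAt.hasFDerivAt.restrictScalars ℝ).comp x planeToComplex.hasFDerivAt
  rw [dbar, h1.fderiv]
  simp [planeToComplex_apply]
  linear_combination deriv h (x 0 + x 1 * Complex.I) * Complex.I_mul_I

theorem dbar_exp_norm_sq (c : ℝ) (x : EuclideanSpace ℝ (Fin 2)) :
    dbar (fun y ↦ (Real.exp (c * ‖y‖ ^ 2 / 2) : ℂ)) x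
      = c * planeToComplex x * Real.exp (c * ‖x‖ ^ 2 / 2) := by
  have h0 : HasFDerivAt (fun y : EuclideanSpace ℝ (Fin 2) ↦ ‖y‖ ^ 2) (2 • innerSL ℝ x) x :=
    (hasStrictFDerivAt_norm_sq x).hasFDerivAt
  have h1 : HasFDerivAt (fun y : EuclideanSpace ℝ (Fin 2) ↦ Real.exp (c * ‖y‖ ^ 2 / 2))
      (Real.exp (c * ‖x‖ ^ 2 / 2) • (c / 2) • 2 • innerSL ℝ x) x := by
    have := (h0.const_mul (c / 2)).exp
    convert! this using 2 <;> ring_nf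
  have h2 := (Complex.ofRealCLM.hasFDerivAt (x := Real.exp (c * ‖x‖ ^ 2 / 2))).comp x h1
  have h3 : fderiv ℝ (fun y : EuclideanSpace ℝ (Fin 2) ↦ (Real.exp (c * ‖y‖ ^ 2 / 2) : ℂ)) x = _ :=
    h2.fderiv
  rw [dbar, h3, planeToComplex_apply]
  simp [EuclideanSpace.inner_single_right]
  ring

/-- The operator on the right is the conjugate of `dbar` by exp(c|x|²/2), which is how the weight
enters. -/
theorem carleman_cauchyRiemann {f : EuclideanSpace ℝ (Fin 2) → ℂ} (hf : ContDiff ℝ 2 f)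
    (hfs : HasCompactSupport f) (c : ℝ) :
    4 * c * ∫ x, ‖f x‖ ^ 2 ≤ ∫ x, ‖dbar f x - c * planeToComplex x * f x‖ ^ 2 := by
  have hd : ∀ x, HasFDerivAt f (fderiv ℝ f x) x := fun x ↦
    (hf.differentiable (by norm_num) x).hasFDerivAt
  have hre : ∀ x v, fderiv ℝ (fun y ↦ (f y).re) x v = (fderiv ℝ f x v).re := fun x v ↦ by
    have := (Complex.reCLM.hasFDerivAt.comp x (hd x)).fderiv
    exact congr($this v)
  have him : ∀ x v, fderiv ℝ (fun y ↦ (f y).im) x v = (fderiv ℝ f x v).im := fun x v ↦ by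
    have := (Complex.imCLM.hasFDerivAt.comp x (hd x)).fderiv
    exact congr($this v)
  have key := carleman_cauchyRiemann_real (a := fun y ↦ (f y).re) (b := fun y ↦ (f y).im)
    (Complex.reCLM.contDiff.comp hf) (Complex.imCLM.contDiff.comp hf)
    (hfs.comp_left (g := Complex.re) rfl) (hfs.comp_left (g := Complex.im) rfl) c
  have hn : ∀ z : ℂ, ‖z‖ ^ 2 = z.re ^ 2 + z.im ^ 2 := fun z ↦ by
    rw [Complex.sq_norm, Complex.normSq_apply]; ring
  simp only [hre, him] at key
  simp only [hn]
  refine key.trans_eq (integral_congr_ae (.of_forall fun x ↦ ?_))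
  simp [dbar, planeToComplex_apply]
  ring

/-- The Carleman estimate with the singular weight `|x|^(-2k) exp (c |x|²)`. -/
theorem carleman_weighted {w : EuclideanSpace ℝ (Fin 2) → ℂ} (hw : ContDiff ℝ 2 w)
    {χ : EuclideanSpace ℝ (Fin 2) → ℝ} (hχ : ContDiff ℝ 2 χ) (hχs : HasCompactSupport χ)
    (h0 : (0 : EuclideanSpace ℝ (Fin 2)) ∉ tsupport χ) (c : ℝ) (k : ℕ) :
    4 * c * ∫ x, Real.exp (c * ‖x‖ ^ 2) * (‖x‖ ^ (2 * k))⁻¹ * (χ x ^ 2 * ‖w x‖ ^ 2) ≤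
      ∫ x, Real.exp (c * ‖x‖ ^ 2) * (‖x‖ ^ (2 * k))⁻¹ *
        ‖(χ x : ℂ) * dbar w x + dbar (fun y ↦ (χ y : ℂ)) x * w x‖ ^ 2 := by
  -- The factor z^(-k) is holomorphic away from 0, so it passes through `dbar` without an error
  -- term. This is why the constant 4c does not depend on k.
  let P : EuclideanSpace ℝ (Fin 2) → ℂ := fun x ↦
    (Real.exp (c * ‖x‖ ^ 2 / 2) : ℂ) * ((planeToComplex x) ^ k)⁻¹
  have hne : ∀ x : EuclideanSpace ℝ (Fin 2), x ≠ 0 → planeToComplex x ≠ 0 := fun x hx ↦ by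
    rw [← norm_ne_zero_iff, norm_planeToComplex]; exact norm_ne_zero_iff.2 hx
  have hexp : ContDiff ℝ 2 fun x : EuclideanSpace ℝ (Fin 2) ↦
      (Real.exp (c * ‖x‖ ^ 2 / 2) : ℂ) :=
    Complex.ofRealCLM.contDiff.comp (((contDiff_const.mul (contDiff_norm_sq ℝ)).div_const _).exp)
  have hpow : ∀ x : EuclideanSpace ℝ (Fin 2), x ≠ 0 →
      ContDiffAt ℝ 2 (fun x ↦ ((planeToComplex x) ^ k)⁻¹) x := fun x hx ↦
    (planeToComplex.contDiff.contDiffAt.pow k).inv (pow_ne_zero _ (hne x hx))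
  have hP : ContDiffOn ℝ 2 P {0}ᶜ := fun x hx ↦
    (hexp.contDiffAt.mul (hpow x hx)).contDiffWithinAt
  have hχC : ContDiff ℝ 2 fun x ↦ (χ x : ℂ) := Complex.ofRealCLM.contDiff.comp hχ
  have hχ0 : tsupport χ ⊆ {0}ᶜ := fun x hx hx0 ↦ h0 ((mem_singleton_iff.1 hx0) ▸ hx)
  have hf : ContDiff ℝ 2 fun x ↦ χ x • (P x * w x) :=
    ContDiffOn.contDiff_smul_of_tsupport_subset isOpen_compl_singleton hχ
      hχ0 (hP.mul hw.contDiffOn)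
  have hPn : ∀ x, ‖P x‖ ^ 2 = Real.exp (c * ‖x‖ ^ 2) * (‖x‖ ^ (2 * k))⁻¹ := fun x ↦ by
    simp only [P, norm_mul, norm_inv, norm_pow, norm_planeToComplex, Complex.norm_real,
      Real.norm_eq_abs, Real.abs_exp, mul_pow, inv_pow]
    rw [← Real.exp_nat_mul, ← pow_mul, mul_comm k 2]
    congr 2
    push_cast
    ring
  have key := carleman_cauchyRiemann hf hχs.smul_right c
  refine (le_of_eq ?_).trans (key.trans (le_of_eq ?_))
  · congr 2 with x
    rw [norm_smul, norm_mul, mul_pow, mul_pow, hPn, Real.norm_eq_abs, sq_abs]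
    ring
  · congr 1 with x
    by_cases hx : x ∈ tsupport χ
    · have hx0 : x ≠ 0 := fun h ↦ h0 (h ▸ hx)
      have hPd : DifferentiableAt ℝ P x :=
        ((hP.contDiffAt (isOpen_compl_singleton.mem_nhds hx0)).differentiableAt (by norm_num))
      have hwd := hw.differentiable (by norm_num) x
      have hχd := hχC.differentiable (by norm_num) x
      have hdP : dbar P x = c * planeToComplex x * P x := by
        have h1 : dbar (fun x ↦ ((planeToComplex x) ^ k)⁻¹) x = 0 :=
          dbar_comp_planeToComplex (h := fun z ↦ (z ^ k)⁻¹)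
            ((differentiableAt_id.pow k).inv (pow_ne_zero _ (hne x hx0)))
        have h2 := dbar_mul (hexp.differentiable (by norm_num) x)
          ((hpow x hx0).differentiableAt (by norm_num))
        rw [dbar_exp_norm_sq, h1] at h2
        refine h2.trans ?_
        simp only [P]
        ring
      have hdf : dbar (fun x ↦ χ x • (P x * w x)) x
          = P x * ((χ x : ℂ) * dbar w x + dbar (fun y ↦ (χ y : ℂ)) x * w x)
            + c * planeToComplex x * (χ x • (P x * w x)) := by
        have h1 := dbar_mul hχd (hPd.fun_mul hwd)
        rw [dbar_mul hPd hwd, hdP] at h1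
        simp only [Complex.real_smul]
        rw [h1]
        ring
      rw [hdf, add_sub_cancel_right, norm_mul, mul_pow, hPn]
    · have hz : (fun x ↦ χ x • (P x * w x)) =ᶠ[nhds x] fun _ ↦ 0 := by
        filter_upwards [(isClosed_tsupport χ).isOpen_compl.mem_nhds hx] with y hy
        rw [image_eq_zero_of_notMem_tsupport hy, zero_smul]
      have hz' : (fun y ↦ (χ y : ℂ)) =ᶠ[nhds x] fun _ ↦ 0 := by
        filter_upwards [(isClosed_tsupport χ).isOpen_compl.mem_nhds hx] with y hy
        rw [image_eq_zero_of_notMem_tsupport hy, Complex.ofReal_zero]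
      simp only [dbar, hz.fderiv_eq, hz'.fderiv_eq, image_eq_zero_of_notMem_tsupport hx]
      simp

end Carleman

/-! ### The Carleman estimate for |∂w/∂z̄| ≤ C|w|. -/

section UniqueContinuation

theorem continuous_of_continuousOn_of_tsupport_subset {X Y : Type*} [TopologicalSpace X]
    [TopologicalSpace Y] [Zero Y] {f : X → Y} {U : Set X} (hU : IsOpen U)
    (hf : ContinuousOn f U) (hs : tsupport f ⊆ U) : Continuous f := by
  rw [continuous_iff_continuousAt]
  intro x
  by_cases hx : x ∈ U
  · exact hf.continuousAt (hU.mem_nhds hx)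
  · have : f =ᶠ[nhds x] fun _ ↦ 0 := by
      filter_upwards [(isClosed_tsupport f).isOpen_compl.mem_nhds fun h ↦ hx (hs h)] with y hy
        using image_eq_zero_of_notMem_tsupport hy
    exact continuousAt_const.congr this.symm

variable {ι : Type*} [Fintype ι] {w : ι → EuclideanSpace ℝ (Fin 2) → ℂ} {R K : ℝ}

theorem continuous_dbar {f : EuclideanSpace ℝ (Fin 2) → ℂ} (hf : ContDiff ℝ 2 f) :
    Continuous (dbar f) := by
  have h := fun v ↦ ((hf.fderiv_right (m := 1) (by norm_num)).clm_apply
    (contDiff_const (c := v))).continuous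
  exact (h _).add (continuous_const.mul (h _))

theorem tsupport_dbar_ofReal_subset {χ : EuclideanSpace ℝ (Fin 2) → ℝ} :
    tsupport (dbar fun y ↦ (χ y : ℂ)) ⊆ tsupport χ := by
  refine closure_minimal (fun x hx ↦ ?_) (isClosed_tsupport χ)
  by_contra h
  apply hx
  have hz' : (fun y ↦ (χ y : ℂ)) =ᶠ[nhds x] fun _ ↦ 0 := by
    filter_upwards [(isClosed_tsupport χ).isOpen_compl.mem_nhds h] with y hy
    rw [image_eq_zero_of_notMem_tsupport hy, Complex.ofReal_zero]
  simp only [dbar, hz'.fderiv_eq]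
  simp

/-- The weight is singular only at the origin, which the support of χ avoids. -/
theorem integrable_weight_mul {χ F : EuclideanSpace ℝ (Fin 2) → ℝ} (hχs : HasCompactSupport χ)
    (h0 : (0 : EuclideanSpace ℝ (Fin 2)) ∉ tsupport χ) (hF : Continuous F)
    (hFs : ∀ x ∉ tsupport χ, F x = 0) (c : ℝ) (k : ℕ) :
    Integrable fun x ↦ Real.exp (c * ‖x‖ ^ 2) * (‖x‖ ^ (2 * k))⁻¹ * F x := by
  have hWc : ContinuousOn (fun x : EuclideanSpace ℝ (Fin 2) ↦
      Real.exp (c * ‖x‖ ^ 2) * (‖x‖ ^ (2 * k))⁻¹) {0}ᶜ := by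
    refine ContinuousOn.mul (by fun_prop) (ContinuousOn.inv₀ (by fun_prop) fun x hx ↦ ?_)
    exact pow_ne_zero _ (norm_ne_zero_iff.2 hx)
  have hs : tsupport (fun x ↦ Real.exp (c * ‖x‖ ^ 2) * (‖x‖ ^ (2 * k))⁻¹ * F x) ⊆ tsupport χ :=
    closure_minimal (fun x hx ↦ by_contra fun h' ↦ hx (by simp [hFs x h'])) (isClosed_tsupport χ)
  refine Continuous.integrable_of_hasCompactSupport ?_ ?_
  · exact continuous_of_continuousOn_of_tsupport_subset isOpen_compl_singleton
      (hWc.mul hF.continuousOn)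
      (hs.trans fun x hx hx0 ↦ h0 ((mem_singleton_iff.1 hx0) ▸ hx))
  · exact hχs.mono' ((subset_tsupport _).trans hs)

/-- The Carleman estimate for solutions of a differential inequality `|∂w/∂z̄| ≤ C |w|`. -/
theorem carleman_of_norm_dbar_le (hw : ∀ i, ContDiff ℝ 2 (w i))
    (hD : ∀ x ∈ ball (0 : EuclideanSpace ℝ (Fin 2)) R,
      ∑ i, ‖dbar (w i) x‖ ^ 2 ≤ K * ∑ i, ‖w i x‖ ^ 2)
    {χ : EuclideanSpace ℝ (Fin 2) → ℝ} (hχ : ContDiff ℝ 2 χ) (hχs : HasCompactSupport χ)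
    (h0 : (0 : EuclideanSpace ℝ (Fin 2)) ∉ tsupport χ) (hχR : tsupport χ ⊆ ball 0 R)
    {c : ℝ} (hcK : K ≤ c) (k : ℕ) :
    c * ∫ x, Real.exp (c * ‖x‖ ^ 2) * (‖x‖ ^ (2 * k))⁻¹ * (χ x ^ 2 * ∑ i, ‖w i x‖ ^ 2) ≤
      ∫ x, Real.exp (c * ‖x‖ ^ 2) * (‖x‖ ^ (2 * k))⁻¹ *
        (‖dbar (fun y ↦ (χ y : ℂ)) x‖ ^ 2 * ∑ i, ‖w i x‖ ^ 2) := by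
  have hχC : ContDiff ℝ 2 fun x ↦ (χ x : ℂ) := Complex.ofRealCLM.contDiff.comp hχ
  let W : EuclideanSpace ℝ (Fin 2) → ℝ := fun x ↦ Real.exp (c * ‖x‖ ^ 2) * (‖x‖ ^ (2 * k))⁻¹
  have hW0 : ∀ x, 0 ≤ W x := fun x ↦ by positivity
  have hint : ∀ F : EuclideanSpace ℝ (Fin 2) → ℝ, Continuous F → (∀ x ∉ tsupport χ, F x = 0) →
      Integrable fun x ↦ W x * F x := fun F hF hFs ↦ integrable_weight_mul hχs h0 hF hFs c k
  have hwc := fun i ↦ (hw i).continuous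
  have hdc := fun i ↦ continuous_dbar (hw i)
  have hχc := hχ.continuous
  have hdχc := continuous_dbar hχC
  have hχz : ∀ x, x ∉ tsupport χ → χ x = 0 := fun x hx ↦ image_eq_zero_of_notMem_tsupport hx
  have hdz : ∀ x, x ∉ tsupport χ → dbar (fun y ↦ (χ y : ℂ)) x = 0 := fun x hx ↦
    image_eq_zero_of_notMem_tsupport fun h ↦ hx (tsupport_dbar_ofReal_subset h)
  have hi1 : ∀ i, Integrable fun x ↦ W x * (χ x ^ 2 * ‖w i x‖ ^ 2) := fun i ↦
    hint _ (by have := hwc i; fun_prop) (fun x hx ↦ by simp [hχz x hx])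
  have hi2 : ∀ i, Integrable fun x ↦ W x *
      ‖(χ x : ℂ) * dbar (w i) x + dbar (fun y ↦ (χ y : ℂ)) x * w i x‖ ^ 2 := fun i ↦
    hint _ (by have := hwc i; have := hdc i; fun_prop)
      (fun x hx ↦ by simp [hχz x hx, hdz x hx])
  have hi3 : Integrable fun x ↦ W x * (χ x ^ 2 * ∑ i, ‖w i x‖ ^ 2) :=
    hint _ (by fun_prop) (fun x hx ↦ by simp [hχz x hx])
  have hi4 : Integrable fun x ↦ W x * (‖dbar (fun y ↦ (χ y : ℂ)) x‖ ^ 2 * ∑ i, ‖w i x‖ ^ 2) :=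
    hint _ (by fun_prop) (fun x hx ↦ by simp [hdz x hx])
  have hsum : 4 * c * ∫ x, W x * (χ x ^ 2 * ∑ i, ‖w i x‖ ^ 2)
      ≤ ∫ x, ∑ i, W x * ‖(χ x : ℂ) * dbar (w i) x + dbar (fun y ↦ (χ y : ℂ)) x * w i x‖ ^ 2 := by
    simp only [Finset.mul_sum]
    rw [integral_finsetSum _ fun i _ ↦ hi1 i, integral_finsetSum _ fun i _ ↦ hi2 i,
      Finset.mul_sum]
    exact Finset.sum_le_sum fun i _ ↦ carleman_weighted (hw i) hχ hχs h0 c k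
  -- By (p + q)² ≤ 2p² + 2q² and K ≤ c, the term with χ `dbar` w costs at most 2c of the 4c
  -- available on the left. The other 2c remain, and the common factor 2 cancels.
  have hle : ∫ x, ∑ i, W x * ‖(χ x : ℂ) * dbar (w i) x + dbar (fun y ↦ (χ y : ℂ)) x * w i x‖ ^ 2
      ≤ ∫ x, (2 * c * (W x * (χ x ^ 2 * ∑ i, ‖w i x‖ ^ 2))
        + 2 * (W x * (‖dbar (fun y ↦ (χ y : ℂ)) x‖ ^ 2 * ∑ i, ‖w i x‖ ^ 2))) := by
    refine integral_mono (integrable_finsetSum _ fun i _ ↦ hi2 i)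
      ((hi3.const_mul _).add (hi4.const_mul _)) fun x ↦ ?_
    simp only
    have h1 : ∀ i, ‖(χ x : ℂ) * dbar (w i) x + dbar (fun y ↦ (χ y : ℂ)) x * w i x‖ ^ 2
        ≤ 2 * (χ x ^ 2 * ‖dbar (w i) x‖ ^ 2)
          + 2 * (‖dbar (fun y ↦ (χ y : ℂ)) x‖ ^ 2 * ‖w i x‖ ^ 2) := by
      intro i
      have h2 := norm_add_le ((χ x : ℂ) * dbar (w i) x) (dbar (fun y ↦ (χ y : ℂ)) x * w i x)
      have h3 := pow_le_pow_left₀ (norm_nonneg _) h2 2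
      refine h3.trans ((add_sq_le).trans (le_of_eq ?_))
      rw [norm_mul, norm_mul, mul_pow, mul_pow, Complex.norm_real, Real.norm_eq_abs, sq_abs]
      ring
    have h4 : χ x ^ 2 * ∑ i, ‖dbar (w i) x‖ ^ 2 ≤ c * (χ x ^ 2 * ∑ i, ‖w i x‖ ^ 2) := by
      by_cases hx : x ∈ tsupport χ
      · have hS : 0 ≤ ∑ i, ‖w i x‖ ^ 2 := Finset.sum_nonneg fun _ _ ↦ by positivity
        have h5 := (hD x (hχR hx)).trans (mul_le_mul_of_nonneg_right hcK hS)
        calc _ ≤ χ x ^ 2 * (c * ∑ i, ‖w i x‖ ^ 2) := by gcongr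
          _ = _ := by ring
      · simp [hχz x hx]
    calc ∑ i, W x * ‖(χ x : ℂ) * dbar (w i) x + dbar (fun y ↦ (χ y : ℂ)) x * w i x‖ ^ 2
        ≤ ∑ i, W x * (2 * (χ x ^ 2 * ‖dbar (w i) x‖ ^ 2)
          + 2 * (‖dbar (fun y ↦ (χ y : ℂ)) x‖ ^ 2 * ‖w i x‖ ^ 2)) :=
          Finset.sum_le_sum fun i _ ↦ mul_le_mul_of_nonneg_left (h1 i) (hW0 x)
      _ = W x * (2 * (χ x ^ 2 * ∑ i, ‖dbar (w i) x‖ ^ 2)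
          + 2 * (‖dbar (fun y ↦ (χ y : ℂ)) x‖ ^ 2 * ∑ i, ‖w i x‖ ^ 2)) := by
          rw [← Finset.mul_sum, Finset.sum_add_distrib]
          simp only [Finset.mul_sum]
      _ ≤ W x * (2 * (c * (χ x ^ 2 * ∑ i, ‖w i x‖ ^ 2))
          + 2 * (‖dbar (fun y ↦ (χ y : ℂ)) x‖ ^ 2 * ∑ i, ‖w i x‖ ^ 2)) := by
          have := hW0 x
          gcongr
      _ = _ := by ring
  rw [integral_add (hi3.const_mul _) (hi4.const_mul _), integral_const_mul,
    integral_const_mul] at hle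
  have := hsum.trans hle
  simp only [W] at this
  linarith

end UniqueContinuation

/-! ### Annular cutoffs and strong unique continuation. -/

section StrongUniqueContinuation

theorem exists_norm_dbar_ofReal_le {χ : EuclideanSpace ℝ (Fin 2) → ℝ} (hχ : ContDiff ℝ 2 χ)
    (hχs : HasCompactSupport χ) : ∃ C ≥ 0, ∀ x, ‖dbar (fun y ↦ (χ y : ℂ)) x‖ ≤ C := by
  have hc := continuous_dbar (Complex.ofRealCLM.contDiff.comp hχ)
  obtain ⟨C, hC⟩ := hc.bounded_above_of_compact_support
    (hχs.mono' ((subset_tsupport _).trans tsupport_dbar_ofReal_subset))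
  exact ⟨C, (norm_nonneg _).trans (hC 0), hC⟩

theorem dbar_ofReal_congr {χ χ' : EuclideanSpace ℝ (Fin 2) → ℝ} {x : EuclideanSpace ℝ (Fin 2)}
    (h : χ =ᶠ[nhds x] χ') : dbar (fun y ↦ (χ y : ℂ)) x = dbar (fun y ↦ (χ' y : ℂ)) x := by
  have h' : (fun y ↦ (χ y : ℂ)) =ᶠ[nhds x] fun y ↦ (χ' y : ℂ) := h.mono fun y hy ↦ by
    simp only [hy]
  simp only [dbar, h'.fderiv_eq]

theorem dbar_ofReal_const (r : ℝ) (x : EuclideanSpace ℝ (Fin 2)) :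
    dbar (fun _ ↦ (r : ℂ)) x = 0 := by
  simp [dbar]

theorem dbar_one_sub_comp_smul {β : EuclideanSpace ℝ (Fin 2) → ℝ} (hβ : ContDiff ℝ 2 β) (r : ℝ)
    (x : EuclideanSpace ℝ (Fin 2)) :
    dbar (fun y ↦ ((1 - β (r • y) : ℝ) : ℂ)) x = -r * dbar (fun y ↦ (β y : ℂ)) (r • x) := by
  have hC : ContDiff ℝ 2 fun x ↦ (β x : ℂ) := Complex.ofRealCLM.contDiff.comp hβ
  have h1 := (hC.differentiable (by norm_num) (r • x)).hasFDerivAt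
  have h2 : HasFDerivAt (fun y : EuclideanSpace ℝ (Fin 2) ↦ r • y)
      (r • ContinuousLinearMap.id ℝ _) x := (hasFDerivAt_id x).const_smul r
  have h3 := (h1.comp x h2).const_sub (1 : ℂ)
  have h4 := h3.fderiv
  simp only [Function.comp_def] at h4
  simp only [dbar, Complex.ofReal_sub, Complex.ofReal_one, h4]
  simp
  ring

/-- A cutoff function which is `1` on the annulus `2 δ < |x| ≤ R₁` and whose Cauchy-Riemann
derivative is controlled by `δ⁻¹` inside, and uniformly outside. -/
theorem exists_annular_cutoff {R₁ R₂ : ℝ} (h1 : 0 < R₁) (h12 : R₁ < R₂) :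
    ∃ C ≥ 0, ∀ δ > 0, 2 * δ < R₁ → ∃ χ : EuclideanSpace ℝ (Fin 2) → ℝ,
      ContDiff ℝ 2 χ ∧ HasCompactSupport χ ∧ 0 ∉ tsupport χ ∧ tsupport χ ⊆ closedBall 0 R₂ ∧
      (∀ x, 2 * δ < ‖x‖ → ‖x‖ < R₁ → χ x = 1) ∧
      (∀ x, 2 * δ < ‖x‖ → ‖x‖ < R₁ → dbar (fun y ↦ (χ y : ℂ)) x = 0) ∧
      (∀ x, ‖x‖ ≤ 2 * δ → ‖dbar (fun y ↦ (χ y : ℂ)) x‖ ≤ C * δ⁻¹) ∧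
      (∀ x, R₁ ≤ ‖x‖ → ‖dbar (fun y ↦ (χ y : ℂ)) x‖ ≤ C) := by
  let o : ContDiffBump (0 : EuclideanSpace ℝ (Fin 2)) := ⟨R₁, R₂, h1, h12⟩
  let β : ContDiffBump (0 : EuclideanSpace ℝ (Fin 2)) := ⟨1, 2, one_pos, one_lt_two⟩
  have ho : ContDiff ℝ 2 o := o.contDiff
  have hβ : ContDiff ℝ 2 β := β.contDiff
  obtain ⟨C₁, hC₁0, hC₁⟩ := exists_norm_dbar_ofReal_le ho o.hasCompactSupport
  obtain ⟨C₂, hC₂0, hC₂⟩ := exists_norm_dbar_ofReal_le hβ β.hasCompactSupport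
  refine ⟨max C₁ C₂, hC₁0.trans (le_max_left _ _), fun δ hδ hδR ↦ ?_⟩
  -- The inner cutoff is a fixed bump rescaled by δ⁻¹, hence the factor δ⁻¹ in its derivative; the
  -- outer bump does not depend on δ.
  let i : EuclideanSpace ℝ (Fin 2) → ℝ := fun x ↦ 1 - β (δ⁻¹ • x)
  have hi : ContDiff ℝ 2 i := contDiff_const.sub (hβ.comp (contDiff_const_smul _))
  have hnorm : ∀ x : EuclideanSpace ℝ (Fin 2), ‖δ⁻¹ • x‖ = ‖x‖ / δ := fun x ↦ by
    rw [norm_smul, norm_inv, Real.norm_of_nonneg hδ.le, inv_mul_eq_div]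
  have hi1 : ∀ x, 2 * δ < ‖x‖ → i x = 1 := fun x hx ↦ by
    have : β (δ⁻¹ • x) = 0 := β.zero_of_le_dist (by
      rw [dist_zero_right, hnorm, le_div_iff₀ hδ]; exact hx.le)
    simp [i, this]
  have hi0 : ∀ x, ‖x‖ ≤ δ → i x = 0 := fun x hx ↦ by
    have : β (δ⁻¹ • x) = 1 := β.one_of_mem_closedBall (by
      rw [mem_closedBall_zero_iff, hnorm, div_le_iff₀ hδ]; simpa [β] using hx)
    simp [i, this]
  have ho1 : ∀ x, ‖x‖ < R₁ → o x = 1 := fun x hx ↦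
    o.one_of_mem_closedBall (mem_closedBall_zero_iff.2 hx.le)
  have hev_lt : ∀ x : EuclideanSpace ℝ (Fin 2), ‖x‖ < R₁ → ∀ᶠ y in nhds x, ‖y‖ < R₁ :=
    fun x hx ↦ continuous_norm.continuousAt.eventually_lt continuousAt_const hx
  have hev_gt : ∀ x : EuclideanSpace ℝ (Fin 2), 2 * δ < ‖x‖ → ∀ᶠ y in nhds x, 2 * δ < ‖y‖ :=
    fun x hx ↦ continuousAt_const.eventually_lt continuous_norm.continuousAt hx
  refine ⟨fun x ↦ o x * i x, ho.mul hi, o.hasCompactSupport.mul_right, ?_, ?_, ?_, ?_, ?_, ?_⟩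
  · rw [notMem_tsupport_iff_eventuallyEq]
    filter_upwards [ball_mem_nhds (0 : EuclideanSpace ℝ (Fin 2)) hδ] with x hx
    simp [hi0 x (mem_ball_zero_iff.1 hx).le]
  · exact tsupport_mul_subset_left.trans o.tsupport_eq.subset
  · intro x h2 h3
    simp [hi1 x h2, ho1 x h3]
  · intro x h2 h3
    rw [dbar_ofReal_congr (χ' := fun _ ↦ 1), dbar_ofReal_const]
    filter_upwards [hev_lt x h3, hev_gt x h2] with y h4 h5
    simp [hi1 y h5, ho1 y h4]
  · intro x hx
    rw [dbar_ofReal_congr (χ' := i), dbar_one_sub_comp_smul hβ, norm_mul, norm_neg,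
      Complex.norm_real, norm_inv, Real.norm_of_nonneg hδ.le, mul_comm]
    · gcongr
      exact (hC₂ _).trans (le_max_right _ _)
    · filter_upwards [hev_lt x (hx.trans_lt hδR)] with y h4
      simp [ho1 y h4]
  · intro x hx
    rw [dbar_ofReal_congr (χ' := o)]
    · exact (hC₁ _).trans (le_max_left _ _)
    · filter_upwards [hev_gt x (hδR.trans_le hx)] with y h5
      simp [hi1 y h5]

variable {ι : Type*} [Fintype ι] {w : ι → EuclideanSpace ℝ (Fin 2) → ℂ} {R K : ℝ}

/-- Strong unique continuation for the inequality `|∂w/∂z̄| ≤ C |w|` in the plane. -/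
theorem eq_zero_of_norm_dbar_le_of_flat (hw : ∀ i, ContDiff ℝ 2 (w i))
    (hD : ∀ x ∈ ball (0 : EuclideanSpace ℝ (Fin 2)) R,
      ∑ i, ‖dbar (w i) x‖ ^ 2 ≤ K * ∑ i, ‖w i x‖ ^ 2)
    (hflat : ∀ m : ℕ, ∃ A, ∀ x ∈ ball (0 : EuclideanSpace ℝ (Fin 2)) R,
      ∑ i, ‖w i x‖ ^ 2 ≤ A * ‖x‖ ^ (2 * m))
    {x₀ : EuclideanSpace ℝ (Fin 2)} (hx₀ : x₀ ∈ ball 0 R) : ∑ i, ‖w i x₀‖ ^ 2 = 0 := by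
  set S : EuclideanSpace ℝ (Fin 2) → ℝ := fun x ↦ ∑ i, ‖w i x‖ ^ 2 with hS
  change S x₀ = 0
  have hS0 : ∀ x, 0 ≤ S x := fun x ↦ Finset.sum_nonneg fun _ _ ↦ by positivity
  have hSc : Continuous S := by
    have hwc := fun i ↦ (hw i).continuous
    fun_prop
  by_contra hne
  have hpos : 0 < S x₀ := (hS0 x₀).lt_of_ne' hne
  have hx₀R : ‖x₀‖ < R := mem_ball_zero_iff.1 hx₀
  have hx₀0 : 0 < ‖x₀‖ := by
    rw [norm_pos_iff]
    rintro rfl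
    obtain ⟨A, hA⟩ := hflat 1
    have := hA 0 hx₀
    simp only [norm_zero] at this
    have h2 : S 0 ≤ 0 := by simpa using this
    linarith
  -- radii `‖x₀‖ < R₀ < R₁ < R₂ < R`
  obtain ⟨R₁, hR₁, hR₁R⟩ := exists_between hx₀R
  obtain ⟨R₂, hR₁₂, hR₂R⟩ := exists_between hR₁R
  obtain ⟨R₀, hR₀, hR₀₁⟩ := exists_between hR₁
  have hR₀0 : 0 < R₀ := hx₀0.trans hR₀
  have hR₁0 : 0 < R₁ := hR₀0.trans hR₀₁
  obtain ⟨s', hs'0, hs'⟩ := Metric.mem_nhds_iff.1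
    (hSc.continuousAt.eventually_const_lt (half_lt_self hpos))
  obtain ⟨s, hs0, hss', hsx, hsR⟩ : ∃ s > 0, s ≤ s' ∧ s ≤ ‖x₀‖ / 2 ∧ s ≤ R₀ - ‖x₀‖ :=
    ⟨min s' (min (‖x₀‖ / 2) (R₀ - ‖x₀‖)), by
      refine lt_min hs'0 (lt_min (by positivity) (by linarith)), min_le_left _ _,
      (min_le_right _ _).trans (min_le_left _ _), (min_le_right _ _).trans (min_le_right _ _)⟩
  have hball : ∀ x ∈ ball x₀ s, S x₀ / 2 < S x ∧ ‖x₀‖ / 2 < ‖x‖ ∧ ‖x‖ < R₀ := fun x hx ↦ by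
    have h1 : ‖x - x₀‖ < s := by rwa [← dist_eq_norm]
    have h2 := norm_sub_norm_le x₀ x
    have h3 := norm_sub_norm_le x x₀
    rw [norm_sub_rev] at h2
    exact ⟨hs' (ball_subset_ball hss' hx), by linarith, by linarith⟩
  obtain ⟨C, hC0, hC⟩ := exists_annular_cutoff hR₁0 hR₁₂
  obtain ⟨B, hB⟩ := (isCompact_closedBall (0 : EuclideanSpace ℝ (Fin 2)) R₂).exists_bound_of_continuousOn
    hSc.continuousOn
  have hB' : ∀ x, ‖x‖ ≤ R₂ → S x ≤ B := fun x hx ↦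
    (le_abs_self _).trans (hB x (mem_closedBall_zero_iff.2 hx))
  have hBnn : 0 ≤ B := (hS0 x₀).trans (hB' x₀ (by linarith))
  set c := max K 1 with hc
  have hc1 : 1 ≤ c := le_max_right _ _
  set E := Real.exp (c * R₂ ^ 2) with hE
  have hE0 : 0 < E := Real.exp_pos _
  set v := volume.real (ball x₀ s) with hv
  set V := volume.real (closedBall (0 : EuclideanSpace ℝ (Fin 2)) R₂) with hV
  have hv0 : 0 < v := ENNReal.toReal_pos (measure_ball_pos _ _ hs0).ne' measure_ball_lt_top.ne
  -- Near x₀ the weight is at least R₀^(-2k); on the outer annulus, where the cutoff varies, it is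
  -- at most E R₁^(-2k). Flatness makes the inner contribution negligible as δ → 0. Since R₀ < R₁,
  -- large k gives a contradiction.
  have hk : ∀ k : ℕ, (R₀ ^ (2 * k))⁻¹ * (S x₀ / 2) * v
      ≤ (1 + E * C ^ 2 * B) * (R₁ ^ (2 * k))⁻¹ * V := by
    intro k
    -- The squared cutoff derivative costs δ^(-2) and the weight |x|^(-2k), so order 2(k + 2) leaves
    -- a factor δ².
    obtain ⟨A', hA'⟩ := hflat (k + 2)
    obtain ⟨A, hA0, hA⟩ : ∃ A ≥ 0, ∀ x ∈ ball (0 : EuclideanSpace ℝ (Fin 2)) R,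
        S x ≤ A * ‖x‖ ^ (2 * (k + 2)) := ⟨max A' 0, le_max_right _ _, fun x hx ↦
      (hA' x hx).trans (mul_le_mul_of_nonneg_right (le_max_left _ _) (by positivity))⟩
    obtain ⟨δ, hδ0, hδR, hδx, hδ⟩ : ∃ δ > 0, 2 * δ < R₁ ∧ 2 * δ < ‖x₀‖ / 2 ∧
        E * (16 * C ^ 2 * A) * δ ^ 2 ≤ (R₁ ^ (2 * k))⁻¹ := by
      have h1 : Filter.Tendsto (fun δ : ℝ ↦ E * (16 * C ^ 2 * A) * δ ^ 2)
          (nhdsWithin 0 (Ioi 0)) (nhds 0) := by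
        have : ContinuousAt (fun δ : ℝ ↦ E * (16 * C ^ 2 * A) * δ ^ 2) 0 := by fun_prop
        simpa using this.tendsto.mono_left nhdsWithin_le_nhds
      have h2 : Filter.Tendsto (fun δ : ℝ ↦ 2 * δ) (nhdsWithin 0 (Ioi 0)) (nhds 0) := by
        have : ContinuousAt (fun δ : ℝ ↦ 2 * δ) 0 := by fun_prop
        simpa using this.tendsto.mono_left nhdsWithin_le_nhds
      have hp : 0 < (R₁ ^ (2 * k))⁻¹ := by positivity
      obtain ⟨δ, h⟩ := ((h2.eventually_lt_const hR₁0).and ((h2.eventually_lt_const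
        (half_pos hx₀0)).and ((h1.eventually_lt_const hp).and self_mem_nhdsWithin))).exists
      exact ⟨δ, h.2.2.2, h.1, h.2.1, h.2.2.1.le⟩
    obtain ⟨χ, hχ, hχs, hχ0, hχR, hχ1, hχmid, hχin, hχout⟩ := hC δ hδ0 hδR
    have hcar := carleman_of_norm_dbar_le hw hD hχ hχs hχ0
      (hχR.trans (closedBall_subset_ball hR₂R)) (le_max_left K 1) k
    rw [← hc] at hcar
    have hχC : ContDiff ℝ 2 fun x ↦ (χ x : ℂ) := Complex.ofRealCLM.contDiff.comp hχ
    have hdχc := continuous_dbar hχC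
    have hdz : ∀ x, x ∉ tsupport χ → dbar (fun y ↦ (χ y : ℂ)) x = 0 := fun x hx ↦
      image_eq_zero_of_notMem_tsupport fun h ↦ hx (tsupport_dbar_ofReal_subset h)
    have hupper : ∫ x, Real.exp (c * ‖x‖ ^ 2) * (‖x‖ ^ (2 * k))⁻¹ *
        (‖dbar (fun y ↦ (χ y : ℂ)) x‖ ^ 2 * S x) ≤ (1 + E * C ^ 2 * B) * (R₁ ^ (2 * k))⁻¹ * V := by
      rw [← setIntegral_eq_integral_of_forall_compl_eq_zero
        (s := closedBall (0 : EuclideanSpace ℝ (Fin 2)) R₂)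
        fun x hx ↦ by rw [hdz x fun h ↦ hx (hχR h)]; simp]
      refine (Real.le_norm_self _).trans
        (norm_setIntegral_le_of_norm_le_const measure_closedBall_lt_top fun x hx ↦ ?_)
      rw [Real.norm_of_nonneg (by have := hS0 x; positivity)]
      have hxR₂ : ‖x‖ ≤ R₂ := mem_closedBall_zero_iff.1 hx
      have hexp : Real.exp (c * ‖x‖ ^ 2) ≤ E := by
        rw [hE]; gcongr
      have hSx := hS0 x
      have hp : 0 < (R₁ ^ (2 * k))⁻¹ := by positivity
      have hmore : 0 ≤ E * C ^ 2 * B * (R₁ ^ (2 * k))⁻¹ := by positivity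
      rcases le_or_gt ‖x‖ (2 * δ) with h | h
      · have hx4 : (‖x‖ ^ (2 * k))⁻¹ * S x ≤ A * ‖x‖ ^ 4 := by
          have h1 := hA x (mem_ball_zero_iff.2 (hxR₂.trans_lt hR₂R))
          rcases (norm_nonneg x).eq_or_lt with h0 | h0
          · have : S x ≤ 0 := by simpa [← h0] using h1
            have h3 : S x = 0 := le_antisymm this hSx
            rw [h3, mul_zero]; positivity
          · rw [inv_mul_le_iff₀ (by positivity)]
            refine h1.trans (le_of_eq ?_)
            rw [mul_add, pow_add]; ring
        calc Real.exp (c * ‖x‖ ^ 2) * (‖x‖ ^ (2 * k))⁻¹ * (‖dbar (fun y ↦ (χ y : ℂ)) x‖ ^ 2 * S x)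
            = Real.exp (c * ‖x‖ ^ 2) * ‖dbar (fun y ↦ (χ y : ℂ)) x‖ ^ 2
              * ((‖x‖ ^ (2 * k))⁻¹ * S x) := by ring
          _ ≤ E * (C * δ⁻¹) ^ 2 * (A * (2 * δ) ^ 4) := by
              have := hχin x h
              have h5 : (‖x‖ ^ (2 * k))⁻¹ * S x ≤ A * (2 * δ) ^ 4 := hx4.trans (by gcongr)
              exact mul_le_mul (by gcongr) h5 (by positivity) (by positivity)
          _ = E * (16 * C ^ 2 * A) * δ ^ 2 := by field_simp; ring
          _ ≤ (R₁ ^ (2 * k))⁻¹ := hδ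
          _ ≤ (1 + E * C ^ 2 * B) * (R₁ ^ (2 * k))⁻¹ := by linarith
      · rcases lt_or_ge ‖x‖ R₁ with h' | h'
        · rw [hχmid x h h']
          simp only [norm_zero]
          have : 0 ≤ (1 + E * C ^ 2 * B) * (R₁ ^ (2 * k))⁻¹ := by positivity
          simpa using this
        · calc _ ≤ E * (R₁ ^ (2 * k))⁻¹ * (C ^ 2 * B) := by
                have := hχout x h'
                have := hB' x hxR₂
                gcongr
            _ ≤ (1 + E * C ^ 2 * B) * (R₁ ^ (2 * k))⁻¹ := by linarith
    have hint : Integrable fun x ↦ Real.exp (c * ‖x‖ ^ 2) * (‖x‖ ^ (2 * k))⁻¹ *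
        (χ x ^ 2 * S x) := by
      refine integrable_weight_mul hχs hχ0 ?_ (fun x hx ↦ ?_) c k
      · have := hχ.continuous
        fun_prop
      · simp [image_eq_zero_of_notMem_tsupport hx]
    have hnn : ∀ x, 0 ≤ Real.exp (c * ‖x‖ ^ 2) * (‖x‖ ^ (2 * k))⁻¹ * (χ x ^ 2 * S x) := fun x ↦ by
      have := hS0 x
      positivity
    have hlower : (R₀ ^ (2 * k))⁻¹ * (S x₀ / 2) * v ≤
        ∫ x, Real.exp (c * ‖x‖ ^ 2) * (‖x‖ ^ (2 * k))⁻¹ * (χ x ^ 2 * S x) := by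
      refine le_trans ?_ (setIntegral_le_integral hint (.of_forall hnn) (s := ball x₀ s))
      have h1 : ∫ _ in ball x₀ s, (R₀ ^ (2 * k))⁻¹ * (S x₀ / 2)
          = (R₀ ^ (2 * k))⁻¹ * (S x₀ / 2) * v := by
        rw [setIntegral_const, smul_eq_mul, mul_comm]
      rw [← h1]
      refine setIntegral_mono_on (integrableOn_const measure_ball_lt_top.ne) hint.integrableOn
        measurableSet_ball fun x hx ↦ ?_
      obtain ⟨h2, h3, h4⟩ := hball x hx
      rw [hχ1 x (hδx.trans h3) (h4.trans hR₀₁), one_pow, one_mul]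
      have h5 : 1 ≤ Real.exp (c * ‖x‖ ^ 2) := Real.one_le_exp (by positivity)
      have h6 : 0 < ‖x‖ := lt_trans (by positivity) h3
      calc (R₀ ^ (2 * k))⁻¹ * (S x₀ / 2) = 1 * (R₀ ^ (2 * k))⁻¹ * (S x₀ / 2) := by ring
        _ ≤ _ := by gcongr
    refine hlower.trans (le_trans ?_ hupper)
    refine le_trans ?_ hcar
    exact le_mul_of_one_le_left (integral_nonneg hnn) hc1
  -- The ratio (R₁/R₀)^(2k) is unbounded in k, whereas `hk` bounds it.
  have hq : 1 < (R₁ / R₀) ^ 2 := one_lt_pow₀ ((one_lt_div hR₀0).2 hR₀₁) two_ne_zero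
  obtain ⟨k, hkk⟩ := pow_unbounded_of_one_lt ((1 + E * C ^ 2 * B) * V / (S x₀ / 2 * v)) hq
  have h1 := hk k
  rw [div_lt_iff₀ (by positivity), ← pow_mul, div_pow] at hkk
  have h2 : (R₁ ^ (2 * k)) * ((R₀ ^ (2 * k))⁻¹ * (S x₀ / 2) * v)
      ≤ (R₁ ^ (2 * k)) * ((1 + E * C ^ 2 * B) * (R₁ ^ (2 * k))⁻¹ * V) := by gcongr
  have h3 : (R₁ ^ (2 * k)) * ((1 + E * C ^ 2 * B) * (R₁ ^ (2 * k))⁻¹ * V)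
      = (1 + E * C ^ 2 * B) * V := by field_simp
  rw [h3] at h2
  have h4 : (R₁ ^ (2 * k)) * ((R₀ ^ (2 * k))⁻¹ * (S x₀ / 2) * v)
      = R₁ ^ (2 * k) / R₀ ^ (2 * k) * (S x₀ / 2 * v) := by ring
  rw [h4] at h2
  linarith

end StrongUniqueContinuation

/-! ### Order of vanishing at the origin and growth on balls. -/

section VanishingOrder

universe v

theorem iteratedFDeriv_fderiv_eq_zero_iff {E F : Type*} [NormedAddCommGroup E] [NormedSpace ℝ E]
    [NormedAddCommGroup F] [NormedSpace ℝ F] {f : E → F} {x : E} {j : ℕ} :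
    iteratedFDeriv ℝ j (fderiv ℝ f) x = 0 ↔ iteratedFDeriv ℝ (j + 1) f x = 0 := by
  rw [← norm_eq_zero, norm_iteratedFDeriv_fderiv, norm_eq_zero]

theorem iteratedFDeriv_zero_eq_zero_iff {E F : Type*} [NormedAddCommGroup E] [NormedSpace ℝ E]
    [NormedAddCommGroup F] [NormedSpace ℝ F] {f : E → F} {x : E} :
    iteratedFDeriv ℝ 0 f x = 0 ↔ f x = 0 := by
  rw [← norm_eq_zero, norm_iteratedFDeriv_zero, norm_eq_zero]

variable {E F : Type v} [NormedAddCommGroup E] [NormedSpace ℝ E]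
  [NormedAddCommGroup F] [NormedSpace ℝ F] {f : E → F}

/-- A smooth function whose derivatives of order `< m` vanish at `0` is `O(|x|^m)`. -/
theorem ContDiff.exists_norm_le_pow_of_iteratedFDeriv_eq_zero [ProperSpace E]
    (hf : ContDiff ℝ ∞ f) {m : ℕ} (h0 : ∀ j < m, iteratedFDeriv ℝ j f 0 = 0) (R : ℝ) :
    ∃ A ≥ 0, ∀ x : E, ‖x‖ ≤ R → ‖f x‖ ≤ A * ‖x‖ ^ m := by
  -- The inductive step passes to `fderiv ℝ f`, valued in `E →L[ℝ] F`; hence F varies, and E and F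
  -- share a universe.
  induction m generalizing F with
  | zero =>
    obtain ⟨A, hA⟩ := (isCompact_closedBall (0 : E) R).exists_bound_of_continuousOn
      hf.continuous.continuousOn
    refine ⟨max A 0, le_max_right _ _, fun x hx ↦ ?_⟩
    rw [pow_zero, mul_one]
    exact (hA x (mem_closedBall_zero_iff.2 hx)).trans (le_max_left _ _)
  | succ m ih =>
    obtain ⟨A, hA0, hA⟩ := ih (hf.fderiv_right (m := ∞) (by simp)) fun j hj ↦
      iteratedFDeriv_fderiv_eq_zero_iff.2 (h0 (j + 1) (by omega))
    refine ⟨A, hA0, fun x hx ↦ ?_⟩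
    have hf0 : f 0 = 0 := iteratedFDeriv_zero_eq_zero_iff.1 (h0 0 (by omega))
    have := (convex_closedBall (0 : E) ‖x‖).norm_image_sub_le_of_norm_fderiv_le (𝕜 := ℝ) (f := f)
      (C := A * ‖x‖ ^ m) (fun y _ ↦ hf.differentiable (by simp) y) (fun y hy ↦ by
        have hy' : ‖y‖ ≤ ‖x‖ := mem_closedBall_zero_iff.1 hy
        exact (hA y (hy'.trans hx)).trans (by gcongr))
      (mem_closedBall_self (norm_nonneg x)) (mem_closedBall_zero_iff.2 le_rfl)
    rw [hf0, sub_zero, sub_zero] at this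
    rwa [pow_succ, ← mul_assoc]

/-- If the derivatives of order `< k` of a smooth function vanish at `0` and its maximum over the
ball of radius `r` is not bounded below by a multiple of `r ^ k`, then its derivative of order `k`
vanishes too. -/
theorem ContDiff.iteratedFDeriv_eq_zero_of_small_on_balls [ProperSpace E]
    (hf : ContDiff ℝ ∞ f) {k : ℕ} (h0 : ∀ j < k, iteratedFDeriv ℝ j f 0 = 0)
    (hs : ∀ ε > 0, ∀ r₀ > 0, ∃ r, 0 < r ∧ r < r₀ ∧ ∀ x : E, ‖x‖ ≤ r → ‖f x‖ ≤ ε * r ^ k) :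
    iteratedFDeriv ℝ k f 0 = 0 := by
  induction k generalizing F with
  | zero =>
    rw [iteratedFDeriv_zero_eq_zero_iff, ← norm_le_zero_iff]
    refine le_of_forall_pos_le_add fun ε hε ↦ ?_
    obtain ⟨r, hr, -, h⟩ := hs ε hε 1 one_pos
    simpa using h 0 (by simpa using hr.le)
  | succ k ih =>
    have hg : ContDiff ℝ ∞ (fderiv ℝ f) := hf.fderiv_right (by simp)
    have hgg : ContDiff ℝ ∞ (fderiv ℝ (fderiv ℝ f)) := hg.fderiv_right (by simp)
    rw [← iteratedFDeriv_fderiv_eq_zero_iff]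
    refine ih hg (fun j hj ↦ iteratedFDeriv_fderiv_eq_zero_iff.2 (h0 (j + 1) (by omega))) ?_
    -- The second derivative is O(|x|^(k-1)). For k = 0 the truncated exponent is 0 and this is mere
    -- boundedness, which r ≤ 1 makes sufficient in `hBr`.
    obtain ⟨B, hB0, hB⟩ := hgg.exists_norm_le_pow_of_iteratedFDeriv_eq_zero (m := k - 1)
      (fun j hj ↦ iteratedFDeriv_fderiv_eq_zero_iff.2
        (iteratedFDeriv_fderiv_eq_zero_iff.2 (h0 (j + 1 + 1) (by omega)))) 1
    intro ε hε r₀ hr₀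
    obtain ⟨δ, hδ0, hδ1, hδε⟩ : ∃ δ > 0, δ ≤ 1 / 2 ∧ (2 + B) * 2 ^ k * δ ≤ ε := by
      refine ⟨min (1 / 2) (ε / ((2 + B) * 2 ^ k)), by positivity, min_le_left _ _, ?_⟩
      calc _ ≤ (2 + B) * 2 ^ k * (ε / ((2 + B) * 2 ^ k)) := by gcongr; exact min_le_right _ _
        _ = ε := by field_simp
    -- Interpolation: with |f| ≤ δ² r^(k+1), a difference quotient of step δr has size at most 2δ
    -- r^k, and the second derivative adds an error of at most Bδ r^k. Passing to the ball of radius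
    -- r/2 costs 2^k.
    obtain ⟨r, hr, hrr, hsm⟩ := hs (δ ^ 2) (by positivity) (min r₀ 1) (by positivity)
    have hr1 : r ≤ 1 := (hrr.trans_le (min_le_right _ _)).le
    have hrr₀ : r < r₀ := hrr.trans_le (min_le_left _ _)
    have hBr : B * r ^ (k - 1) * r ≤ B * r ^ k := by
      rw [mul_assoc]
      refine mul_le_mul_of_nonneg_left ?_ hB0
      rcases k with _ | k
      · simpa using hr1
      · simp [pow_succ]
    refine ⟨r / 2, by positivity, by linarith, fun x hx ↦ ?_⟩
    have hMain : ‖fderiv ℝ f x‖ ≤ (2 + B) * δ * r ^ k := by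
      refine ContinuousLinearMap.opNorm_le_bound _ (by positivity) fun v ↦ ?_
      rcases eq_or_ne v 0 with rfl | hv
      · simp
      have hv' : 0 < ‖v‖ := norm_pos_iff.2 hv
      set a := δ * r / ‖v‖ with ha
      have ha0 : 0 < a := by positivity
      have hav : ‖a • v‖ = δ * r := by
        rw [norm_smul, Real.norm_of_nonneg ha0.le, ha]; field_simp
      have hball : ∀ z ∈ closedBall x (δ * r), ‖z‖ ≤ r := fun z hz ↦ by
        have h1 : ‖z - x‖ ≤ δ * r := mem_closedBall_iff_norm.1 hz
        have h2 : ‖z‖ ≤ ‖x‖ + ‖z - x‖ := by simpa using norm_add_le x (z - x)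
        nlinarith
      have hxr : ‖x‖ ≤ r := by linarith
      have hG : ∀ z ∈ closedBall x (δ * r), ‖fderiv ℝ f z - fderiv ℝ f x‖
          ≤ B * r ^ (k - 1) * (δ * r) := fun z hz ↦ by
        have := (convex_closedBall (0 : E) r).norm_image_sub_le_of_norm_fderiv_le (𝕜 := ℝ)
          (f := fderiv ℝ f) (C := B * r ^ (k - 1))
          (fun y _ ↦ hg.differentiable (by simp) y) (fun y hy ↦ by
            have hy' : ‖y‖ ≤ r := mem_closedBall_zero_iff.1 hy
            exact (hB y (hy'.trans hr1)).trans (by gcongr))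
          (mem_closedBall_zero_iff.2 hxr) (mem_closedBall_zero_iff.2 (hball z hz))
        exact this.trans (by gcongr; exact mem_closedBall_iff_norm.1 hz)
      have hmv := (convex_closedBall x (δ * r)).norm_image_sub_le_of_norm_fderiv_le' (𝕜 := ℝ)
        (f := f) (φ := fderiv ℝ f x) (fun y _ ↦ hf.differentiable (by simp) y) hG
        (mem_closedBall_self (by positivity)) (y := x + a • v)
        (by rw [mem_closedBall_iff_norm, add_sub_cancel_left, hav])
      rw [add_sub_cancel_left, hav] at hmv
      have h1 := hsm x hxr
      have h2 := hsm (x + a • v) (hball _ (by rw [mem_closedBall_iff_norm, add_sub_cancel_left, hav]))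
      have h3 : ‖fderiv ℝ f x (a • v)‖ ≤ 2 * (δ ^ 2 * r ^ (k + 1))
          + B * r ^ (k - 1) * (δ * r) * (δ * r) := by
        have h4 : fderiv ℝ f x (a • v)
            = f (x + a • v) - f x - (f (x + a • v) - f x - fderiv ℝ f x (a • v)) := by abel
        rw [h4]
        refine (norm_sub_le _ _).trans ?_
        have := norm_sub_le (f (x + a • v)) (f x)
        linarith
      rw [map_smul, norm_smul, Real.norm_of_nonneg ha0.le, ha, div_mul_eq_mul_div,
        div_le_iff₀ hv'] at h3
      have h5 : δ * r * ‖fderiv ℝ f x v‖ ≤ δ * r * ((2 + B) * δ * r ^ k * ‖v‖) := by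
        refine h3.trans ?_
        calc _ = δ * r * ((2 * r ^ k + B * r ^ (k - 1) * r) * δ * ‖v‖) := by rw [pow_succ]; ring
          _ ≤ δ * r * ((2 * r ^ k + B * r ^ k) * δ * ‖v‖) := by gcongr
          _ = _ := by ring
      exact le_of_mul_le_mul_left h5 (by positivity)
    refine hMain.trans ?_
    calc (2 + B) * δ * r ^ k = (2 + B) * 2 ^ k * δ * (r / 2) ^ k := by
          rw [div_pow]; field_simp
      _ ≤ ε * (r / 2) ^ k := by gcongr

end VanishingOrder

/-! ### From the Laplacian to the Cauchy-Riemann operator. -/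

section ComplexGradient

variable {n : ℕ} {u : EuclideanSpace ℝ (Fin 2) → EuclideanSpace ℝ (Fin n)}

/-- Twice the complex derivative `∂u/∂z` of the components of `u`. -/
noncomputable def complexGradient (u : EuclideanSpace ℝ (Fin 2) → EuclideanSpace ℝ (Fin n))
    (i : Fin n) (x : EuclideanSpace ℝ (Fin 2)) : ℂ :=
  (fderiv ℝ u x (EuclideanSpace.single 0 1) i : ℂ)
    - Complex.I * (fderiv ℝ u x (EuclideanSpace.single 1 1) i : ℂ)

theorem sum_norm_sq_complexGradient (x : EuclideanSpace ℝ (Fin 2)) :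
    ∑ i, ‖complexGradient u i x‖ ^ 2 = ∑ α, ‖fderiv ℝ u x (EuclideanSpace.single α 1)‖ ^ 2 := by
  rw [Fin.sum_univ_two, EuclideanSpace.norm_sq_eq, EuclideanSpace.norm_sq_eq,
    ← Finset.sum_add_distrib]
  refine Finset.sum_congr rfl fun i _ ↦ ?_
  rw [Complex.sq_norm, Complex.normSq_apply]
  simp [complexGradient]
  ring

theorem contDiff_complexGradient (hu : ContDiff ℝ ∞ u) (i : Fin n) :
    ContDiff ℝ 2 (complexGradient u i) := by
  have h : ∀ v, ContDiff ℝ 2 fun x ↦ (fderiv ℝ u x v i : ℂ) := fun v ↦ by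
    have h1 : ContDiff ℝ 2 fun x ↦ fderiv ℝ u x v :=
      ((hu.fderiv_right (m := ∞) (by simp)).clm_apply contDiff_const).of_le
        (WithTop.coe_le_coe.2 le_top)
    exact Complex.ofRealCLM.contDiff.comp
      ((EuclideanSpace.proj i : EuclideanSpace ℝ (Fin n) →L[ℝ] ℝ).contDiff.comp h1)
  exact (h _).sub (contDiff_const.mul (h _))

/-- The factorization Δ = (∂₀ + i∂₁)(∂₀ - i∂₁), with mixed derivatives cancelling by symmetry; it
turns the second-order inequality into a first-order one. -/
theorem dbar_complexGradient (hu : ContDiff ℝ ∞ u) (i : Fin n) (x : EuclideanSpace ℝ (Fin 2)) :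
    dbar (complexGradient u i) x = ((∑ α, fderiv ℝ (fun y ↦
      fderiv ℝ u y (EuclideanSpace.single α 1)) x (EuclideanSpace.single α 1)) i : ℝ) := by
  have hd : DifferentiableAt ℝ (fderiv ℝ u) x :=
    (hu.fderiv_right (m := ∞) (by simp)).differentiable (by simp) x
  have h2 : ∀ v, HasFDerivAt (fun y ↦ fderiv ℝ u y v) ((fderiv ℝ (fderiv ℝ u) x).flip v) x :=
    fun v ↦ by
      have := hd.hasFDerivAt.clm_apply (hasFDerivAt_const v x)
      simpa using this
  have h3 : ∀ v, HasFDerivAt (fun y ↦ (fderiv ℝ u y v i : ℂ))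
      (Complex.ofRealCLM ∘L ((EuclideanSpace.proj i : EuclideanSpace ℝ (Fin n) →L[ℝ] ℝ) ∘L
        (fderiv ℝ (fderiv ℝ u) x).flip v)) x := fun v ↦
    Complex.ofRealCLM.hasFDerivAt.comp x
      ((EuclideanSpace.proj i : EuclideanSpace ℝ (Fin n) →L[ℝ] ℝ).hasFDerivAt.comp x (h2 v))
  have h4 := (h3 (EuclideanSpace.single 0 1)).sub
    ((h3 (EuclideanSpace.single 1 1)).const_mul Complex.I)
  have h5 : fderiv ℝ (complexGradient u i) x = _ := h4.fderiv
  have hsymm : fderiv ℝ (fderiv ℝ u) x (EuclideanSpace.single 0 1) (EuclideanSpace.single 1 1)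
      = fderiv ℝ (fderiv ℝ u) x (EuclideanSpace.single 1 1) (EuclideanSpace.single 0 1) :=
    (hu.contDiffAt.isSymmSndFDerivAt (by
      rw [minSmoothness_of_isRCLikeNormedField]; exact WithTop.coe_le_coe.2 le_top)).eq _ _
  rw [dbar, h5, Fin.sum_univ_two, (h2 _).fderiv, (h2 _).fderiv]
  simp [hsymm]
  linear_combination (-(fderiv ℝ (fderiv ℝ u) x (EuclideanSpace.single 1 1)
    (EuclideanSpace.single 1 1) i : ℂ)) * Complex.I_mul_I

/-- Strong unique continuation for `|Δu| ≤ C |∇u|` in the plane. -/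
theorem fderiv_eq_zero_of_norm_laplacian_le_of_flat (hu : ContDiff ℝ ∞ u) {R K : ℝ}
    (hL : ∀ x ∈ ball (0 : EuclideanSpace ℝ (Fin 2)) R,
      ‖∑ α, fderiv ℝ (fun y ↦ fderiv ℝ u y (EuclideanSpace.single α 1)) x
        (EuclideanSpace.single α 1)‖ ^ 2
      ≤ K * ∑ α, ‖fderiv ℝ u x (EuclideanSpace.single α 1)‖ ^ 2)
    (hflat : ∀ j, iteratedFDeriv ℝ j (fderiv ℝ u) 0 = 0) {x : EuclideanSpace ℝ (Fin 2)}
    (hx : x ∈ ball 0 R) : fderiv ℝ u x = 0 := by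
  have key := eq_zero_of_norm_dbar_le_of_flat (w := complexGradient u) (R := R) (K := K)
    (contDiff_complexGradient hu) (fun y hy ↦ ?_) (fun m ↦ ?_) hx
  · rw [sum_norm_sq_complexGradient, Fin.sum_univ_two] at key
    have h0 : fderiv ℝ u x (EuclideanSpace.single 0 1) = 0 := by
      rw [← norm_eq_zero, ← sq_eq_zero_iff]
      nlinarith [sq_nonneg ‖fderiv ℝ u x (EuclideanSpace.single 0 1)‖,
        sq_nonneg ‖fderiv ℝ u x (EuclideanSpace.single 1 1)‖]
    have h1 : fderiv ℝ u x (EuclideanSpace.single 1 1) = 0 := by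
      rw [← norm_eq_zero, ← sq_eq_zero_iff]
      nlinarith [sq_nonneg ‖fderiv ℝ u x (EuclideanSpace.single 0 1)‖,
        sq_nonneg ‖fderiv ℝ u x (EuclideanSpace.single 1 1)‖]
    ext v : 1
    have hv : v = v 0 • EuclideanSpace.single 0 1 + v 1 • EuclideanSpace.single 1 1 := by
      ext i
      fin_cases i <;> simp
    rw [hv, map_add, map_smul, map_smul, h0, h1]
    simp
  · refine (le_of_eq ?_).trans ((hL y hy).trans (le_of_eq ?_))
    · rw [EuclideanSpace.norm_sq_eq]
      refine Finset.sum_congr rfl fun i _ ↦ ?_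
      rw [dbar_complexGradient hu, Complex.norm_real]
    · rw [sum_norm_sq_complexGradient]
  · obtain ⟨A, hA0, hA⟩ := (hu.fderiv_right (m := ∞)
      (by simp)).exists_norm_le_pow_of_iteratedFDeriv_eq_zero (m := m) (fun j _ ↦ hflat j) R
    refine ⟨2 * A ^ 2, fun y hy ↦ ?_⟩
    have h1 := hA y (mem_ball_zero_iff.1 hy).le
    rw [sum_norm_sq_complexGradient, Fin.sum_univ_two]
    have h2 : ∀ α : Fin 2, ‖fderiv ℝ u y (EuclideanSpace.single α 1)‖ ^ 2
        ≤ A ^ 2 * ‖y‖ ^ (2 * m) := fun α ↦ by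
      have h3 := (fderiv ℝ u y).le_of_opNorm_le h1 (EuclideanSpace.single α 1)
      rw [PiLp.norm_single, norm_one, mul_one] at h3
      calc _ ≤ (A * ‖y‖ ^ m) ^ 2 := by gcongr
        _ = _ := by rw [mul_pow, ← pow_mul, mul_comm m 2]
    linarith [h2 0, h2 1]

end ComplexGradient

/-! ### Polynomial growth of maxima on concentric balls. -/

section Doubling

variable {E : Type*} [NormedAddCommGroup E] [NormedSpace ℝ E] [ProperSpace E]

/-- A function comparable to a power of the norm, in the sense of a Lipschitz bound along rays
of order `j` and of a lower bound of order `j + 1` on balls, has maxima on concentric balls of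
at most polynomial growth. -/
theorem exists_isGreatest_sq_le_rpow_mul {ρ : E → ℝ} (hc : ContinuousOn ρ (closedBall 0 1))
    (h0 : ∀ x, 0 ≤ ρ x) {j : ℕ} {A c : ℝ} (hA : 0 ≤ A) (hc0 : 0 < c)
    (hup : ∀ x, ‖x‖ ≤ 1 → ∀ s, 0 < s → s ≤ ‖x‖ →
      ρ x ≤ ρ ((s / ‖x‖) • x) + A * ‖x‖ ^ j * (‖x‖ - s))
    (hlow : ∀ r, 0 < r → r ≤ 1 → ∃ x, ‖x‖ ≤ r ∧ c * r ^ (j + 1) ≤ ρ x) :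
    ∃ C : ℝ, ∀ r₁ r₂ : ℝ, 0 < r₁ → r₁ ≤ r₂ → r₂ ≤ 1 → ∃ M₁ M₂ : ℝ,
      IsGreatest ((fun x ↦ ρ x ^ 2) '' closedBall 0 r₁) M₁ ∧
      IsGreatest ((fun x ↦ ρ x ^ 2) '' closedBall 0 r₂) M₂ ∧
      M₂ ≤ (r₂ / r₁) ^ C * M₁ := by
  have hmax : ∀ r, 0 < r → r ≤ 1 → ∃ x, ‖x‖ ≤ r ∧ ∀ y, ‖y‖ ≤ r → ρ y ≤ ρ x := fun r hr hr1 ↦ by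
    obtain ⟨x, hx, hm⟩ := (isCompact_closedBall (0 : E) r).exists_isMaxOn
      (nonempty_closedBall.2 hr.le) (hc.mono (closedBall_subset_closedBall hr1))
    exact ⟨x, mem_closedBall_zero_iff.1 hx, fun y hy ↦ hm (mem_closedBall_zero_iff.2 hy)⟩
  have hgr : ∀ r x, ‖x‖ ≤ r → (∀ y, ‖y‖ ≤ r → ρ y ≤ ρ x) →
      IsGreatest ((fun x ↦ ρ x ^ 2) '' closedBall 0 r) (ρ x ^ 2) := fun r x hx hm ↦ by
    refine ⟨⟨x, mem_closedBall_zero_iff.2 hx, rfl⟩, ?_⟩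
    rintro _ ⟨y, hy, rfl⟩
    exact pow_le_pow_left₀ (h0 y) (hm y (mem_closedBall_zero_iff.1 hy)) 2
  -- B ≥ 1 is needed for Bernoulli's inequality, and A ≤ Bc to absorb the increment into the lower
  -- bound.
  set B : ℝ := max 1 (A / c) with hB
  have hB1 : 1 ≤ B := le_max_left _ _
  -- The final factor 2 accounts for the squares of ρ.
  refine ⟨((j + 1 : ℕ) * B) * (2 : ℕ), fun r₁ r₂ h1 h12 h2 ↦ ?_⟩
  obtain ⟨x₁, hx₁, hm₁⟩ := hmax r₁ h1 (h12.trans h2)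
  obtain ⟨x₂, hx₂, hm₂⟩ := hmax r₂ (h1.trans_le h12) h2
  refine ⟨_, _, hgr r₁ x₁ hx₁ hm₁, hgr r₂ x₂ hx₂ hm₂, ?_⟩
  have hq1 : 1 ≤ r₂ / r₁ := (one_le_div h1).2 h12
  have hq0 : 0 ≤ r₂ / r₁ := zero_le_one.trans hq1
  suffices h : ρ x₂ ≤ (r₂ / r₁) ^ (((j + 1 : ℕ) : ℝ) * B) * ρ x₁ by
    rw [Real.rpow_mul_natCast hq0, ← mul_pow]
    exact pow_le_pow_left₀ (h0 _) h 2
  rcases le_or_gt ‖x₂‖ r₁ with h | h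
  · refine (hm₁ x₂ h).trans (le_mul_of_one_le_left (h0 _) (Real.one_le_rpow hq1 ?_))
    positivity
  · have hx2 : 0 < ‖x₂‖ := h1.trans h
    obtain ⟨y, hy, hyl⟩ := hlow r₁ h1 (h12.trans h2)
    -- The maximum point x₂ is moved radially to the sphere of radius r₁, where ρ is at most ρ(x₁);
    -- only the increment along the ray has to be estimated.
    have e1 := hup x₂ (hx₂.trans h2) r₁ h1 h.le
    have e2 : ρ ((r₁ / ‖x₂‖) • x₂) ≤ ρ x₁ := hm₁ _ (by
      rw [norm_smul, norm_div, norm_norm, Real.norm_of_nonneg h1.le, div_mul_cancel₀ _ hx2.ne'])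
    have e3 : c * r₁ ^ (j + 1) ≤ ρ x₁ := hyl.trans (hm₁ y hy)
    have e4 : A * ‖x₂‖ ^ j * (‖x₂‖ - r₁) ≤ A * (r₂ ^ (j + 1) - r₁ ^ (j + 1)) := by
      have e5 : r₁ ^ (j + 1) ≤ r₂ ^ j * r₁ := by rw [pow_succ]; gcongr
      calc A * ‖x₂‖ ^ j * (‖x₂‖ - r₁) ≤ A * r₂ ^ j * (r₂ - r₁) := by
            have h3 : 0 ≤ ‖x₂‖ - r₁ := by linarith
            have h4 : 0 ≤ r₂ := h1.le.trans h12
            gcongr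
        _ = A * (r₂ ^ (j + 1) - r₂ ^ j * r₁) := by ring
        _ ≤ _ := by gcongr
    have hQ : r₂ ^ (j + 1) = (r₂ / r₁) ^ (j + 1) * r₁ ^ (j + 1) := by
      rw [← mul_pow, div_mul_cancel₀ _ h1.ne']
    have hQ1 : 1 ≤ (r₂ / r₁) ^ (j + 1) := one_le_pow₀ hq1
    rw [Real.rpow_mul hq0, Real.rpow_natCast]
    set Q := (r₂ / r₁) ^ (j + 1)
    have e6 : A * (r₂ ^ (j + 1) - r₁ ^ (j + 1)) ≤ B * (Q - 1) * ρ x₁ := by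
      have hAB : A ≤ B * c := (div_le_iff₀ hc0).1 (le_max_right _ _)
      have hQ0 : 0 ≤ Q - 1 := by linarith
      calc A * (r₂ ^ (j + 1) - r₁ ^ (j + 1)) = A * ((Q - 1) * r₁ ^ (j + 1)) := by rw [hQ]; ring
        _ ≤ B * c * ((Q - 1) * r₁ ^ (j + 1)) := by gcongr
        _ = B * (Q - 1) * (c * r₁ ^ (j + 1)) := by ring
        _ ≤ _ := by gcongr
    -- Bernoulli's inequality turns the increment into a pure power, without a leading constant.
    have e7 : 1 + B * (Q - 1) ≤ Q ^ B := by
      have := one_add_mul_self_le_rpow_one_add (s := Q - 1) (by linarith) hB1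
      simpa using this
    calc ρ x₂ ≤ (1 + B * (Q - 1)) * ρ x₁ := by linarith
      _ ≤ _ := mul_le_mul_of_nonneg_right e7 (h0 _)

end Doubling

/-! ### Upper and lower bounds for the distance from φ(0). -/

section DistanceGrowth

variable {n : ℕ} {N : Type*} [MetricSpace N] [ChartedSpace (EuclideanSpace ℝ (Fin n)) N]
  [IsManifold (𝓡 n) ∞ N]
  [RiemannianBundle (fun x : N ↦ TangentSpace (𝓡 n) x)]
  [IsContMDiffRiemannianBundle (𝓡 n) ∞ (EuclideanSpace ℝ (Fin n))
    (fun x : N ↦ TangentSpace (𝓡 n) x)]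
  [IsRiemannianManifold (𝓡 n) N]
  {ψ : OpenPartialHomeomorph N (EuclideanSpace ℝ (Fin n))}
  {E : Type*} [NormedAddCommGroup E] {φ : E → N}

/-- If the coordinates of `φ` do not vanish to order `k` at `0`, the distance from `φ 0` is at
least of order `k` on small balls. -/
theorem exists_mul_pow_le_dist (hψ : ψ ∈ IsManifold.maximalAtlas (𝓡 n) ∞ N)
    (hφc : ContinuousAt φ 0) (hp : φ 0 ∈ ψ.source) {u : E → EuclideanSpace ℝ (Fin n)}
    (hu : ∀ᶠ x in nhds 0, u x = ψ (φ x) - ψ (φ 0)) {k : ℕ} {ε r₀ : ℝ} (hε : 0 < ε) (hr₀ : 0 < r₀)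
    (hs : ∀ r, 0 < r → r < r₀ → ∃ x, ‖x‖ ≤ r ∧ ε * r ^ k < ‖u x‖) :
    ∃ c > 0, ∀ r, 0 < r → r ≤ 1 → ∃ x, ‖x‖ ≤ r ∧ c * r ^ k ≤ dist (φ 0) (φ x) := by
  obtain ⟨C, hC, hCd⟩ := eventually_norm_chart_sub_le_dist hψ hp
  obtain ⟨r₁, hr₁, hr₁d⟩ := Metric.eventually_nhds_iff.1 (hu.and (hφc.eventually hCd))
  obtain ⟨δ, hδ, hδm⟩ := exists_between (lt_min zero_lt_one (lt_min hr₀ hr₁))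
  rw [lt_min_iff, lt_min_iff] at hδm
  -- The bound known for small radii is applied at radius rδ, so that it reaches all r ≤ 1 at the
  -- cost of δ^k.
  refine ⟨ε * δ ^ k / C, by positivity, fun r hr hr1 ↦ ?_⟩
  have hrδ : r * δ ≤ δ := mul_le_of_le_one_left hδ.le hr1
  obtain ⟨x, hx, hxl⟩ := hs (r * δ) (by positivity) (hrδ.trans_lt hδm.2.1)
  refine ⟨x, hx.trans (mul_le_of_le_one_right hr.le hδm.1.le), ?_⟩
  obtain ⟨h1, h2⟩ := hr₁d (y := x) (by
    rw [dist_zero_right]; exact hx.trans_lt (hrδ.trans_lt hδm.2.2))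
  rw [div_mul_eq_mul_div, div_le_iff₀ hC]
  calc ε * δ ^ k * r ^ k = ε * (r * δ) ^ k := by rw [mul_pow]; ring
    _ ≤ ‖u x‖ := hxl.le
    _ ≤ _ := by rw [h1, mul_comm]; exact h2

/-- If the differential of the coordinates of `φ` is of order `j` at `0`, so is the variation along
rays of the distance from `φ 0`. -/
theorem exists_dist_le_dist_smul_add [NormedSpace ℝ E] [ProperSpace E]
    (hψ : ψ ∈ IsManifold.maximalAtlas (𝓡 n) ∞ N) {Ω : Set E} (hΩ : IsOpen Ω)
    (hΩ1 : closedBall 0 1 ⊆ Ω) (hφψ : MapsTo φ Ω ψ.source)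
    (hu : ContDiffOn ℝ ∞ (fun x ↦ ψ (φ x)) Ω) {j : ℕ} {A : ℝ} (hA0 : 0 ≤ A)
    (hA : ∀ x, ‖x‖ ≤ 1 → ‖fderiv ℝ (fun x ↦ ψ (φ x)) x‖ ≤ A * ‖x‖ ^ j) :
    ∃ A' ≥ 0, ∀ x, ‖x‖ ≤ 1 → ∀ s, 0 < s → s ≤ ‖x‖ →
      dist (φ 0) (φ x) ≤ dist (φ 0) (φ ((s / ‖x‖) • x)) + A' * ‖x‖ ^ j * (‖x‖ - s) := by
  have huT : MapsTo (fun x ↦ ψ (φ x)) Ω ψ.target := fun x hx ↦ ψ.map_source (hφψ hx)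
  obtain ⟨M, hM0, hM⟩ := exists_le_mul_norm_sq
    ((isCompact_closedBall (0 : E) 1).image_of_continuousOn (hu.continuousOn.mono hΩ1))
    ((contDiffOn_chartMetric hψ).continuousOn.mono
      (image_subset_iff.2 fun x hx ↦ huT (hΩ1 hx)))
  refine ⟨√M * A, by positivity, fun x hx s hs hsx ↦ ?_⟩
  have hx0 : 0 < ‖x‖ := hs.trans_le hsx
  have hy : ‖(s / ‖x‖) • x‖ = s := by
    rw [norm_smul, norm_div, norm_norm, Real.norm_of_nonneg hs.le, div_mul_cancel₀ _ hx0.ne']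
  have hseg : segment ℝ ((s / ‖x‖) • x) x ⊆ closedBall 0 ‖x‖ :=
    (convex_closedBall 0 ‖x‖).segment_subset (by rw [mem_closedBall_zero_iff, hy]; exact hsx)
      (by rw [mem_closedBall_zero_iff])
  have hseg1 : segment ℝ ((s / ‖x‖) • x) x ⊆ closedBall 0 1 :=
    hseg.trans (closedBall_subset_closedBall hx)
  have key := dist_chart_symm_le hψ hΩ hu huT (hseg1.trans hΩ1) (M := √M) (A := A * ‖x‖ ^ j)
    (Real.sqrt_nonneg M) (by positivity)
    (fun z hz v ↦ by rw [Real.sq_sqrt hM0]; exact hM _ (mem_image_of_mem _ (hseg1 hz)) v)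
    (fun z hz ↦ by
      have hz' := mem_closedBall_zero_iff.1 (hseg hz)
      refine (hA z (hz'.trans hx)).trans ?_
      gcongr)
  have hn : ‖x - (s / ‖x‖) • x‖ = ‖x‖ - s := by
    have h1 : x - (s / ‖x‖) • x = (1 - s / ‖x‖) • x := by rw [sub_smul, one_smul]
    have h2 : 0 ≤ 1 - s / ‖x‖ := sub_nonneg.2 ((div_le_one hx0).2 hsx)
    rw [h1, norm_smul, Real.norm_of_nonneg h2, sub_mul, div_mul_cancel₀ _ hx0.ne', one_mul]
  rw [hn] at key
  simp only [ψ.left_inv (hφψ (hΩ1 (hseg1 (left_mem_segment ℝ _ _)))),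
    ψ.left_inv (hφψ (hΩ1 (hseg1 (right_mem_segment ℝ _ _))))] at key
  calc dist (φ 0) (φ x) ≤ _ := dist_triangle _ (φ ((s / ‖x‖) • x)) _
    _ ≤ _ := by
      gcongr
      exact key.trans (le_of_eq (by ring))

end DistanceGrowth

/-! ### The dichotomy at the origin. -/

theorem lemma5 {n : ℕ} {N : Type*} [MetricSpace N]
    [ChartedSpace (EuclideanSpace ℝ (Fin n)) N] [IsManifold (𝓡 n) ∞ N]
    [RiemannianBundle (fun x : N ↦ TangentSpace (𝓡 n) x)]
    [IsContMDiffRiemannianBundle (𝓡 n) ∞ (EuclideanSpace ℝ (Fin n))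
      (fun x : N ↦ TangentSpace (𝓡 n) x)]
    [IsRiemannianManifold (𝓡 n) N] [CompleteSpace N] :
    ∃ ε : ℝ, 0 < ε ∧ ε ≤ 1 ∧
      ∀ φ : EuclideanSpace ℝ (Fin 2) → N,
        IsHarmonicOn n φ (ball 0 2) → IsConformalOn n φ (ball 0 2) →
        (∃ U : Set N, IsNormalNeighborhood n (φ 0) U ∧ MapsTo φ (ball 0 2) U) →
        ∃ C : ℝ, ∀ r₁ r₂ : ℝ, 0 < r₁ → r₁ ≤ r₂ → r₂ ≤ ε →
          ∃ M₁ M₂ : ℝ,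
            IsGreatest ((fun x ↦ dist (φ 0) (φ x) ^ 2) '' closedBall 0 r₁) M₁ ∧
            IsGreatest ((fun x ↦ dist (φ 0) (φ x) ^ 2) '' closedBall 0 r₂) M₂ ∧
            M₂ ≤ (r₂ / r₁) ^ C * M₁ := by
  refine ⟨1, one_pos, le_rfl, fun φ hφ _ ⟨U, ⟨ψ, hψN, hψU⟩, hφU⟩ ↦ ?_⟩
  have hψ := hψN.mem_atlas
  have hφψ : MapsTo φ (ball 0 2) ψ.source := hψU ▸ hφU
  have hφc : ContinuousOn φ (ball 0 2) := hφ.smooth.continuousOn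
  have hc1 : closedBall (0 : EuclideanSpace ℝ (Fin 2)) 1 ⊆ ball 0 2 :=
    closedBall_subset_ball (by norm_num)
  have hu : ContDiffOn ℝ ∞ (fun x ↦ ψ (φ x)) (ball 0 2) := contDiffOn_chart_comp hψ hφ.smooth hφψ
  -- Extends the coordinate map to a smooth function on the whole plane, unchanged on the ball of
  -- radius 3/2, a neighbourhood of the closed unit ball.
  let θ : ContDiffBump (0 : EuclideanSpace ℝ (Fin 2)) := ⟨3 / 2, 7 / 4, by norm_num, by norm_num⟩
  set v : EuclideanSpace ℝ (Fin 2) → EuclideanSpace ℝ (Fin n) := fun x ↦ θ x • ψ (φ x) with hv_def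
  have hv : ContDiff ℝ ∞ v := hu.contDiff_smul_of_tsupport_subset isOpen_ball θ.contDiff (by
    rw [θ.tsupport_eq]; exact closedBall_subset_ball (by norm_num [θ]))
  have hvu : EqOn v (fun x ↦ ψ (φ x)) (ball 0 (3 / 2)) := fun x hx ↦ by
    simp only [hv_def]
    rw [θ.one_of_mem_closedBall (ball_subset_closedBall hx), one_smul]
  have hev : ∀ x ∈ ball (0 : EuclideanSpace ℝ (Fin 2)) (3 / 2),
      v =ᶠ[nhds x] fun x ↦ ψ (φ x) := fun x hx ↦ hvu.eventuallyEq_of_mem (isOpen_ball.mem_nhds hx)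
  have h32 : closedBall (0 : EuclideanSpace ℝ (Fin 2)) 1 ⊆ ball 0 (3 / 2) :=
    closedBall_subset_ball (by norm_num)
  have hv0 : v 0 = 0 := by
    rw [hvu (mem_ball_self (by norm_num))]; exact hψN.map_center
  -- Infinite order of vanishing forces φ to be constant on the ball of radius 3/2; otherwise j
  -- below is the exact order of du at 0.
  by_cases hflat : ∀ j, iteratedFDeriv ℝ j (fderiv ℝ v) 0 = 0
  · obtain ⟨K, hK⟩ := hφ.exists_norm_laplacian_sq_le isOpen_ball hψ hφψ rfl
      (isCompact_closedBall 0 (3 / 2)) (closedBall_subset_ball (by norm_num))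
    have hfd : ∀ x ∈ ball (0 : EuclideanSpace ℝ (Fin 2)) (3 / 2), fderiv ℝ v x = 0 := fun x hx ↦
      fderiv_eq_zero_of_norm_laplacian_le_of_flat hv (K := K) (fun y hy ↦ by
        have h1 : ∀ w, (fun z ↦ fderiv ℝ v z w) =ᶠ[nhds y]
            fun z ↦ fderiv ℝ (fun x ↦ ψ (φ x)) z w := fun w ↦
          (hev y hy).fderiv.fun_comp fun L ↦ L w
        simp only [(h1 _).fderiv_eq, (hev y hy).fderiv_eq]
        exact hK y (ball_subset_closedBall hy)) hflat hx
    have hconst : ∀ x ∈ ball (0 : EuclideanSpace ℝ (Fin 2)) (3 / 2), φ x = φ 0 := fun x hx ↦ by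
      have h0 : (0 : EuclideanSpace ℝ (Fin 2)) ∈ ball 0 (3 / 2) := mem_ball_self (by norm_num)
      have h1 : v x = v 0 := isOpen_ball.is_const_of_fderiv_eq_zero
        (convex_ball 0 (3 / 2)).isPreconnected (hv.differentiable (by simp)).differentiableOn hfd hx h0
      rw [hvu hx, hvu h0] at h1
      have hb : ball (0 : EuclideanSpace ℝ (Fin 2)) (3 / 2) ⊆ ball 0 2 :=
        ball_subset_ball (by norm_num)
      exact ψ.injOn (hφψ (hb hx)) (hφψ (hb h0)) h1
    have hgr : ∀ r, 0 < r → r ≤ 1 →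
        IsGreatest ((fun x ↦ dist (φ 0) (φ x) ^ 2) '' closedBall 0 r) 0 := fun r hr hr1 ↦ by
      refine ⟨⟨0, mem_closedBall_self hr.le, by simp⟩, ?_⟩
      rintro _ ⟨y, hy, rfl⟩
      simp [hconst y (h32 (closedBall_subset_closedBall hr1 hy))]
    exact ⟨0, fun r₁ r₂ h1 h12 h2 ↦ ⟨0, 0, hgr r₁ h1 (h12.trans h2),
      hgr r₂ (h1.trans_le h12) h2, by simp⟩⟩
  · push Not at hflat
    classical
    set j := Nat.find hflat
    have hj : iteratedFDeriv ℝ j (fderiv ℝ v) 0 ≠ 0 := Nat.find_spec hflat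
    have hjm : ∀ i < j, iteratedFDeriv ℝ i (fderiv ℝ v) 0 = 0 := fun i hi ↦
      not_not.1 (Nat.find_min hflat hi)
    obtain ⟨A, hA0, hA⟩ := (hv.fderiv_right (m := ∞)
      (by simp)).exists_norm_le_pow_of_iteratedFDeriv_eq_zero hjm 1
    -- If this failed, the derivative of order j + 1 of v would vanish at 0, against the choice of
    -- j. The derivatives of v up to order j vanish there, the one of order 0 because the chart is
    -- centred at φ(0).
    have hlow : ∃ ε > 0, ∃ r₀ > 0, ∀ r, 0 < r → r < r₀ →
        ∃ x, ‖x‖ ≤ r ∧ ε * r ^ (j + 1) < ‖v x‖ := by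
      by_contra! h
      refine hj (iteratedFDeriv_fderiv_eq_zero_iff.2
        (hv.iteratedFDeriv_eq_zero_of_small_on_balls (fun i hi ↦ ?_) h))
      rcases i with _ | i
      · exact iteratedFDeriv_zero_eq_zero_iff.2 hv0
      · exact iteratedFDeriv_fderiv_eq_zero_iff.1 (hjm i (Nat.lt_of_succ_lt_succ hi))
    obtain ⟨ε, hε, r₀, hr₀, hs⟩ := hlow
    have h0 : (0 : EuclideanSpace ℝ (Fin 2)) ∈ ball 0 2 := mem_ball_self (by norm_num)
    obtain ⟨c, hc, hcl⟩ := exists_mul_pow_le_dist hψ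
      (hφc.continuousAt (isOpen_ball.mem_nhds h0)) (hφψ h0)
      ((hev 0 (mem_ball_self (by norm_num))).mono fun x hx ↦ by
        rw [hx, hψN.map_center, sub_zero]) hε hr₀ hs
    obtain ⟨A', hA'0, hA'⟩ := exists_dist_le_dist_smul_add hψ isOpen_ball hc1 hφψ hu hA0
      (j := j) fun x hx ↦ by
        rw [← (hev x (h32 (mem_closedBall_zero_iff.2 hx))).fderiv_eq]; exact hA x hx
    exact exists_isGreatest_sq_le_rpow_mul
      (fun x hx ↦ tendsto_const_nhds.dist ((hφc.mono hc1) x hx)) (fun _ ↦ dist_nonneg) hA'0 hc hA' hcl
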